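/- **Setting.** Let $F/\mathbf F_q$ be an algebraic function field of one variable, let $Q,P_1,\dots,P_n$ be distinct places of degree one, let $v_Q$ be the normalized valuation at $Q$, $\mathcal L(\infty Q)=\bigcup_i\mathcal L(iQ)$, $D=P_1+\dots+P_n$, $\mathrm{ev}(f)=(f(P_1),\dots,f(P_n))$ and $C_u=\mathrm{ev}(\mathcal L(uQ))$. Let $H(Q)$ be the Weierstrass semigroup, generated by positive integers $a_1,\dots,a_t$, let $x_j\in F$ have pole divisor $a_jQ$, and let $\widehat H(Q)=\{u\in H(Q)\mid C_u\ne C_{u-1}\}$. For $0\le i<a_1$ let $b_i=\min\{m\in H(Q)\mid m\equiv i \bmod a_1\}$ and let $y_i$ be the monomial in $x_1,\dots,x_t$ with pole order $b_i$ whose exponent vector is least in the weighted reverse lexicographic order with weights $a_1,\dots,a_t$. The monomials $x_1^my_i$ form an $\mathbf F_q$-basis of $\mathcal L(\infty Q)$; for $s\in H(Q)$, $\varphi_s$ is the one with $-v_Q(\varphi_s)=s$. Let $\eta_i\in\mathcal L(-D+\infty Q)$ have leading monomial $x_1^jy_i$ with $j$ minimal. Write $\mathrm{lc}$ for the leading coefficient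 and $i'=(i+s)\bmod a_1$. Let $\Gamma\subseteq\widehat H(Q)$ and $\tau\in\mathbf N_0$. **Algorithm.** Given $\vec r\in\mathbf F_q^n$, let $h$ be the linear combination of the $\varphi_u$, $u\in\widehat H(Q)$, with $\mathrm{ev}(h)=\vec r$. Suppose $h\neq0$ and put $N=-v_Q(h)$, $\vec r^{(N)}=\vec r$, $f_i^{(N)}=y_i(z-h)$ and $g_i^{(N)}=\eta_i$ for $0\le i<a_1$. For $s\in H(Q)$, $s\le N$, write $$f_i^{(s)}=\sum_j a_{i,j}y_jz+\sum_j b_{i,j}y_j,\qquad g_i^{(s)}=\sum_j c_{i,j}y_jz+\sum_j d_{i,j}y_j$$ with coefficients in $\mathbf F_q[x_1]$, and define $k_i$ by $-v_Q(a_{i,i}y_i)+s=a_1k_i-v_Q(y_{i'})$, and $$c_i=\deg d_{i',i'}-k_i,\quad \bar c_i=\max\{c_i,0\},\quad \mu_i=\mathrm{lc}(a_{i,i}y_i\varphi_s),\quad w_{s,i}=-b_{i,i'}[x_1^{k_i}]/\mu_i,$$ $$\nu(s)=\frac1{a_1}\sum_{0\le i<a_1}\max\{-v_Q(\eta_{i'})+v_Q(y_i)-s,\,0\}.$$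 Choose $w_s=0$ if $s\notin\Gamma$, and if $s\in\Gamma$ choose any $w_s=w\in\mathbf F_q$ with $\sum_{w_{s,i}=w}\bar c_i\ge\sum_{w_{s,i}\ne w}\bar c_i-2\tau+\nu(s)$. Let $s^-$ be the largest element of $H(Q)$ below $s$, put $\vec r^{(s^-)}=\vec r^{(s)}-\mathrm{ev}(w_s\varphi_s)$ and, with $\tilde f_i=f_i^{(s)}(z+w_s\varphi_s)$, $\tilde g_{i'}=g_{i'}^{(s)}(z+w_s\varphi_s)$ and $\rho_i=\mu_i(w_s-w_{s,i})/\mathrm{lc}(d_{i',i'})$, $$(g_{i'}^{(s^-)},f_i^{(s^-)})=\begin{cases}(\tilde g_{i'},\ \tilde f_i)&\text{if }w_{s,i}=w_s,\\(\tilde f_i,\ x_1^{c_i}\tilde f_i-\rho_i\tilde g_{i'})&\text{if }w_{s,i}\ne w_s,\ c_i>0,\\(\tilde g_{i'},\ \tilde f_i-\rho_ix_1^{-c_i}\tilde g_{i'})&\text{if }w_{s,i}\ne w_s,\ c_i\le0.\end{cases}$$ **Proposition.** Fix $s\in\Gamma$ with $s\le N$ and a sequence of values $w_{s'}$ ($s'\in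 H(Q)$, $s<s'\le N$) chosen by the algorithm. If some gap of $H(Q)$ lies strictly between $s$ and $N$, assume also, as the definition of the votes does, that the leading term of $f_i^{(s)}$ is that of $a_{i,i}y_iz$ and the leading term of $g_i^{(s)}$ is that of $d_{i,i}y_i$ for $0\le i<a_1$, where monomials $m z^k$ ($k\in\{0,1\}$) are ordered by $-v_Q(m)+ks$, with ties decided in favour of $z$. Let $\omega_s\in\mathbf F_q$, and let $\vec e$ be a nonzero vector of minimum Hamming weight in the coset $\vec r^{(s)}-\mathrm{ev}(\omega_s\varphi_s)+C_{s-1}$. Then $$\sum_{w_{s,i}=\omega_s}\bar c_i\ \ge\ \sum_{w_{s,i}\neq\omega_s}\bar c_i-2\,\mathrm{wt}(\vec e)+\nu(s).$$ -/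

import Mathlib

open Polynomial

noncomputable section

/-- `F` is an algebraic function field of one variable over `K`: a finite extension of a rational
function field `K(x)` with `x` transcendental over `K`. -/
def IsFunctionField (K F : Type*) [Field K] [Field F] [Algebra K F] : Prop :=
  ∃ x : F, Transcendental K x ∧ FiniteDimensional (IntermediateField.adjoin K {x}) F

/-- A place of `F/K`, given by its valuation ring `V` with `K ⊆ V ⊊ F`. The place itself is the
maximal ideal of `V`, that is, `V.nonunits`. -/
def IsPlace (K : Type*) {F : Type*} [Field K] [Field F] [Algebra K F]
    (V : ValuationSubring F) : Prop :=
  V ≠ ⊤ ∧ ∀ c : K, algebraMap K F c ∈ V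

/-- The place has degree one: the residue field of `V` is `K`. -/
def IsDegreeOne (K : Type*) {F : Type*} [Field K] [Field F] [Algebra K F]
    (V : ValuationSubring F) : Prop :=
  ∀ f ∈ V, ∃ c : K, f - algebraMap K F c ∈ V.nonunits

open Classical in
/-- The value `f(P) ∈ K` of `f` at a place of degree one with valuation ring `V`
(`0` if `f` has a pole there). -/
def placeValue (K : Type*) {F : Type*} [Field K] [Field F] [Algebra K F]
    (V : ValuationSubring F) (f : F) : K :=
  if h : ∃ c : K, f - algebraMap K F c ∈ V.nonunits then h.choose else 0

/-- Pairwise distinct places `Q, P_1, …, P_n` of degree one of `F/K`, together with the (unique)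
normalized discrete valuation `v_Q` that belongs to `Q`. -/
structure PointedCurve (K F : Type*) [Field K] [Field F] [Algebra K F] (n : ℕ) where
  Q : ValuationSubring F
  P : Fin n → ValuationSubring F
  isPlace_Q : IsPlace K Q
  isPlace_P : ∀ i, IsPlace K (P i)
  isDegreeOne_Q : IsDegreeOne K Q
  isDegreeOne_P : ∀ i, IsDegreeOne K (P i)
  P_injective : Function.Injective P
  P_ne_Q : ∀ i, P i ≠ Q
  vQ : AddValuation F (WithTop ℤ)
  vQ_nonneg_iff : ∀ f : F, 0 ≤ vQ f ↔ f ∈ Q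
  vQ_normalized : ∃ f : F, vQ f = 1

namespace PointedCurve

variable {K F : Type*} [Field K] [Field F] [Algebra K F] {n : ℕ} (X : PointedCurve K F n)

/-- `-v_Q(f)`, for `f ≠ 0`. -/
def poleOrd (f : F) : ℤ := -(X.vQ f).untopD 0

/-- `𝓛(∞Q) = ⋃ i, 𝓛(iQ)`: the functions without a pole outside `Q`. -/
def LInf : Set F := {f | ∀ V : ValuationSubring F, IsPlace K V → V ≠ X.Q → f ∈ V}

/-- The Riemann-Roch space `𝓛(mQ)`. -/
def LSpace (m : ℤ) : Set F := {f | f ∈ X.LInf ∧ ((-m : ℤ) : WithTop ℤ) ≤ X.vQ f}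

/-- `𝓛(-D + ∞Q)` for `D = P_1 + ⋯ + P_n`. -/
def LMinusD : Set F := {f | f ∈ X.LInf ∧ ∀ i, f ∈ (X.P i).nonunits}

/-- `ev(f) = (f(P_1), …, f(P_n))`. -/
def ev (f : F) : Fin n → K := fun i => placeValue K (X.P i) f

/-- The one-point code `C_u = ev(𝓛(uQ))`. -/
def code (u : ℤ) : Set (Fin n → K) := X.ev '' X.LSpace u

/-- The Weierstrass semigroup `H(Q)`. -/
def H : Set ℕ := {m | ∃ f ∈ X.LInf, X.vQ f = ((-(m : ℤ) : ℤ) : WithTop ℤ)}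

/-- `Ĥ(Q) = {u ∈ H(Q) | C_u ≠ C_{u-1}}`. -/
def Hhat : Set ℕ := {u | u ∈ X.H ∧ X.code (u : ℤ) ≠ X.code ((u : ℤ) - 1)}

end PointedCurve

/-- The weight `a_1 m_1 + ⋯ + a_t m_t` of an exponent vector. -/
def expWeight {t : ℕ} (a m : Fin t → ℕ) : ℕ := ∑ j, a j * m j

/-- `m ≺ m'` in the weighted reverse lexicographic order with weights `a`. -/
def WRevLexLT {t : ℕ} (a m m' : Fin t → ℕ) : Prop :=
  expWeight a m < expWeight a m' ∨
    (expWeight a m = expWeight a m' ∧ ∃ i, (∀ j < i, m j = m' j) ∧ m' i < m i)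

/-- The choices made once for the curve, before a word is received. The `t + 1` generators are
indexed by `Fin (t + 1)`, so that `a 0`, `x 0` are the distinguished ones (`a_1`, `x_1`); the objects
indexed by residues modulo `a 0` are functions on `ℕ` of which only the values at `i < a 0` are
used.
* `a` generates `H(Q)` and `x j` has pole divisor `a j • Q`;
* `b i` is the least element of `H(Q)` congruent to `i` modulo `a 0`;
* `expo i` is the `≺`-least exponent vector of weight `b i`;
* `η i ∈ 𝓛(-D + ∞Q)` has a leading monomial `x_1^j y_i` with `j` minimal. -/
structure StandardForm {K F : Type*} [Field K] [Field F] [Algebra K F] {n : ℕ}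
    (X : PointedCurve K F n) (t : ℕ) where
  a : Fin (t + 1) → ℕ
  a_pos : ∀ j, 0 < a j
  a_gen : (AddSubmonoid.closure (Set.range a) : Set ℕ) = X.H
  x : Fin (t + 1) → F
  x_mem : ∀ j, x j ∈ X.LInf
  x_pole : ∀ j, X.vQ (x j) = ((-(a j : ℤ) : ℤ) : WithTop ℤ)
  b : ℕ → ℕ
  b_least : ∀ i < a 0, IsLeast {m | m ∈ X.H ∧ m % a 0 = i} (b i)
  expo : ℕ → Fin (t + 1) → ℕ
  expo_weight : ∀ i < a 0, expWeight a (expo i) = b i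
  expo_least : ∀ i < a 0, ∀ m, expWeight a m = b i → m ≠ expo i → WRevLexLT a (expo i) m
  η : ℕ → F
  η_mem : ∀ i < a 0, η i ∈ X.LMinusD
  η_ne : ∀ i < a 0, η i ≠ 0
  η_class : ∀ i < a 0, X.poleOrd (η i) % (a 0 : ℤ) = i
  η_least : ∀ i < a 0, ∀ f ∈ X.LMinusD, f ≠ 0 → X.poleOrd f % (a 0 : ℤ) = i →
    X.poleOrd (η i) ≤ X.poleOrd f

namespace StandardForm

variable {K F : Type*} [Field K] [Field F] [Algebra K F] {n : ℕ} {X : PointedCurve K F n} {t : ℕ}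
  (S : StandardForm X t)

/-- `a_1`. -/
def a1 : ℕ := S.a 0

/-- `x_1`. -/
def x1 : F := S.x 0

/-- `y_i`, the monomial in the `x_j` with exponent vector `expo i`. -/
def y (i : ℕ) : F := ∏ j, S.x j ^ S.expo i j

/-- `φ_s`, for `s ∈ H(Q)`: the monomial `x_1^m y_j`, `0 ≤ j < a_1`, with `-v_Q(x_1^m y_j) = s`;
explicitly `j = s mod a_1` and `m = (s - b_j) / a_1`. -/
def φ (s : ℕ) : F := S.x1 ^ ((s - S.b (s % S.a1)) / S.a1) * S.y (s % S.a1)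

open Classical in
/-- The coordinates of `f ∈ 𝓛(∞Q)` in the `K[x_1]`-basis `y_0, …, y_{a_1-1}`: polynomials `p_j` with
`f = ∑_{j < a_1} p_j(x_1) y_j`. -/
def coord (f : F) : ℕ → K[X] :=
  if h : ∃ p : ℕ → K[X], f = ∑ j ∈ Finset.range S.a1, aeval S.x1 (p j) * S.y j
  then h.choose else 0

/-- The leading coefficient of a nonzero `f ∈ 𝓛(∞Q)`: the coefficient of `φ_d`, `d = -v_Q(f)`, in the
expression of `f` as a linear combination of the monomials `x_1^m y_j`. -/
def lc (f : F) : K :=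
  let d : ℕ := (X.poleOrd f).toNat
  (S.coord f (d % S.a1)).coeff ((d - S.b (d % S.a1)) / S.a1)

/-- `i' = (i + s) mod a_1`. -/
def idx (s i : ℕ) : ℕ := (i + s) % S.a1

/-! An element `α₀ + α₁ z` of `𝓛(∞Q) z ⊕ 𝓛(∞Q)` is the pair `(α₀, α₁)`. The working data of the
algorithm at `s` are two families `f, g : ℕ → F × F`, of which the members `0, …, a_1 - 1` are used. -/

/-- The substitution `z ↦ z + w φ_s` in `α₀ + α₁ z`. -/
def subst (w : K) (s : ℕ) (e : F × F) : F × F :=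
  (e.1 + algebraMap K F w * S.φ s * e.2, e.2)

/-- With respect to `<_s` (weight `-v_Q(m) + k s` for a monomial `m z^k`, a tie going to `z`), the
leading term of `α₀ + α₁ z` is that of `a_i y_i z`: the leading monomial is `x_1^k y_i z`. -/
def LeadsAtZ (s i : ℕ) (e : F × F) : Prop :=
  e.2 ≠ 0 ∧ X.poleOrd e.2 % (S.a1 : ℤ) = i ∧ (e.1 ≠ 0 → X.poleOrd e.1 ≤ X.poleOrd e.2 + s)

/-- With respect to `<_s`, the leading monomial of `α₀ + α₁ z` is `x_1^k y_i`. -/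
def LeadsAtOne (s i : ℕ) (e : F × F) : Prop :=
  e.1 ≠ 0 ∧ X.poleOrd e.1 % (S.a1 : ℤ) = i ∧ (e.2 ≠ 0 → X.poleOrd e.2 + s < X.poleOrd e.1)

section Pairing

variable (s : ℕ) (f g : ℕ → F × F) (i : ℕ)

/-- `a_{i,i}`, the coefficient polynomial of `y_i z` in `f_i`. -/
def aDiag : K[X] := S.coord (f i).2 i

/-- `d_{i,i}`, the coefficient polynomial of `y_i` in `g_i`. -/
def dDiag : K[X] := S.coord (g i).1 i

/-- `k_i`, determined by `-v_Q(a_{i,i} y_i) + s = a_1 k_i - v_Q(y_{i'})`. -/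
def kPair : ℤ :=
  (X.poleOrd (aeval S.x1 (S.aDiag f i) * S.y i) + s - X.poleOrd (S.y (S.idx s i))) / (S.a1 : ℤ)

/-- `c_i = deg d_{i',i'} - k_i`. -/
def cPair : ℤ := ((S.dDiag g (S.idx s i)).natDegree : ℤ) - S.kPair s f i

/-- `c̄_i = max {c_i, 0}`. -/
def cBar : ℤ := max (S.cPair s f g i) 0

/-- `μ_i = lc(a_{i,i} y_i φ_s)`. -/
def mu : K := S.lc (aeval S.x1 (S.aDiag f i) * S.y i * S.φ s)

/-- The vote `w_{s,i} = - b_{i,i'}[x_1^{k_i}] / μ_i`, where `b_{i,i'}` is the coefficient polynomial of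
`y_{i'}` in `f_i`. -/
def vote : K :=
  -((S.coord (f i).1 (S.idx s i)).coeff (S.kPair s f i).toNat) / S.mu s f i

end Pairing

/-- `ν(s) = (1 / a_1) ∑_{i < a_1} max {-v_Q(η_{i'}) + v_Q(y_i) - s, 0}`. -/
def nu (s : ℕ) : ℚ :=
  (1 / (S.a1 : ℚ)) * ∑ i ∈ Finset.range S.a1,
    ((max (X.poleOrd (S.η (S.idx s i)) - X.poleOrd (S.y i) - s) 0 : ℤ) : ℚ)

open Classical in
/-- `∑_{w_{s,i} = w} c̄_i`, the number of votes for `w`. -/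
def votesFor (s : ℕ) (f g : ℕ → F × F) (w : K) : ℚ :=
  ∑ i ∈ (Finset.range S.a1).filter (fun i => S.vote s f i = w), (S.cBar s f g i : ℚ)

open Classical in
/-- `∑_{w_{s,i} ≠ w} c̄_i`, the number of votes against `w`. -/
def votesAgainst (s : ℕ) (f g : ℕ → F × F) (w : K) : ℚ :=
  ∑ i ∈ (Finset.range S.a1).filter (fun i => S.vote s f i ≠ w), (S.cBar s f g i : ℚ)

/-- The value `w` may be taken for `w_s` by the decoder with code index set `Γ` and radius `τ`. -/
def Admissible (Γ : Set ℕ) (τ s : ℕ) (f g : ℕ → F × F) (w : K) : Prop :=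
  (s ∉ Γ → w = 0) ∧
  (s ∈ Γ → S.votesFor s f g w ≥ S.votesAgainst s f g w - 2 * (τ : ℚ) + S.nu s)

/-- Rebasing: `f', g'` arise from `f, g` at `s` with the value `w`. -/
def IsRebasing (s : ℕ) (w : K) (f g f' g' : ℕ → F × F) : Prop :=
  ∀ i < S.a1,
    let i' := S.idx s i
    let c := S.cPair s f g i
    let F₁ := S.subst w s (f i)
    let G₁ := S.subst w s (g i')
    let ρ : F := algebraMap K F (S.mu s f i * (w - S.vote s f i) / (S.dDiag g i').leadingCoeff)
    (S.vote s f i = w → g' i' = G₁ ∧ f' i = F₁) ∧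
    (S.vote s f i ≠ w → 0 < c → g' i' = F₁ ∧ f' i = S.x1 ^ c.toNat • F₁ - ρ • G₁) ∧
    (S.vote s f i ≠ w → c ≤ 0 → g' i' = G₁ ∧ f' i = F₁ - (ρ * S.x1 ^ (-c).toNat) • G₁)

/-- The data `(s, f, g, r^{(s)})` that the decoder, run on the received word `r`, can reach, where
`h = h_r` is the combination of the `φ_u`, `u ∈ Ĥ(Q)`, with `ev(h) = r`, and `N = -v_Q(h)`.
At each step from `s` to the next smaller nongap `s'` an admissible `w_s = w` is chosen. -/
inductive Reaches (Γ : Set ℕ) (τ : ℕ) (r : Fin n → K) (N : ℕ) :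
    ℕ → (ℕ → F × F) → (ℕ → F × F) → (Fin n → K) → Prop
  | init (h : F) (hspan : h ∈ Submodule.span K (S.φ '' X.Hhat)) (hev : X.ev h = r)
      (hN : X.vQ h = ((-(N : ℤ) : ℤ) : WithTop ℤ)) (f g : ℕ → F × F)
      (hf : ∀ i < S.a1, f i = (-(S.y i * h), S.y i))
      (hg : ∀ i < S.a1, g i = (S.η i, 0)) :
      Reaches Γ τ r N N f g r
  | step (s : ℕ) (f g : ℕ → F × F) (rs : Fin n → K) (w : K) (s' : ℕ) (f' g' : ℕ → F × F)
      (hprev : Reaches Γ τ r N s f g rs)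
      (hw : S.Admissible Γ τ s f g w)
      (hprec : IsGreatest {u | u ∈ X.H ∧ u < s} s')
      (hreb : S.IsRebasing s w f g f' g') :
      Reaches Γ τ r N s' f' g' (rs - X.ev (algebraMap K F w * S.φ s))

/-- `e` is a nonzero vector of minimum Hamming weight in the coset `v + C`. -/
def IsMinWeightIn [DecidableEq K] (v : Fin n → K) (C : Set (Fin n → K)) (e : Fin n → K) : Prop :=
  e ∈ (fun c => v + c) '' C ∧ e ≠ 0 ∧
    ∀ e' ∈ (fun c => v + c) '' C, e' ≠ 0 → hammingNorm e ≤ hammingNorm e'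

end StandardForm

end

/-! Call `α₀ + α₁ z` over `𝓛(∞Q)` a relation of `v` if it vanishes at all points `(P_i, v_i)`. When
the leading terms of `f_i` and `g_i` sit at `y_i z` and `y_i`, the two families form a Gröbner basis
over `K[x_1]` of the relations of `r^{(s)}`. Write the pole orders of their leading parts as `b_i +
a_1 α_i` and `b_i + a_1 β_i`, and that of `η_i` as `b_i + a_1 δ_i`. The inequality compares `∑ α_i`
with two dimension counts.

Upper bound. Rebase with `ω`, whether or not the decoder could choose it. The top coefficient of the
`z`-free part of the substituted `f_i` is `μ_i (ω - w_{s,i})`, so a correction is needed exactly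
where the vote differs from `ω`. The result is a Gröbner basis for the weight `s - 1`, and `α_i`
grows by `c̄_i` at the dissenting indices and is unchanged elsewhere (`IsRebasing.lead`). Write `e =
v' + ev(ψ)`, where `v'` is the shifted word and `ψ` has pole order at most `s - 1`. If `a` vanishes
on the support of `e`, then `a (z + ψ)` is a relation of `v'` led by its `z`-term. Hence the
monomials `m` for which `m z` is not a leading monomial stay independent when evaluated on that
support, and `∑ α_i + (votes against) ≤ wt(e)` (`Leads.sum_le_hammingNorm`).

Lower bound. The `∑ δ_i` monomials below the leading monomials of the `η_i` are independent under
`ev`. Division by the Gröbner basis shows that the image of `ev` lies in a space spanned by `∑ α_i +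
∑ β_i` vectors, so `∑ δ_i ≤ ∑ α_i + ∑ β_i` (`Leads.sum_η_le`). By the definition of `c_i`, the
quantity `-v_Q(η_{i'}) + v_Q(y_i) - s` equals `a_1 (c_i + δ_{i'} - β_{i'} + α_i)`, and `β ≤ δ`
because each `η_j` is a relation (`Leads.le_η`). Summing, `ν(s) ≤ ∑ c̄_i + 2 ∑ α_i`. Since `∑ c̄_i`
is the number of all votes, inserting the upper bound for `∑ α_i` gives the claim.

Both counts use properties of the data at `s` only. If the run crosses gaps, leading terms may be
lost on the way, so generation is not proved from them step by step: independence at `s` is pulled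
back along the run through transition matrices, and generation is then pushed forward from the
initial data (`Reaches.generates`). -/

noncomputable section

/-! ### Degree functions and non-cancellation -/

section Ultrametric

/-- `o` behaves like a degree: `o (x + y) ≤ max (o x) (o y)`. -/
structure IsDegreeLike {M : Type*} [AddCommGroup M] (o : M → WithBot ℤ) : Prop where
  zero : o 0 = ⊥
  add_le : ∀ x y, o (x + y) ≤ max (o x) (o y)
  neg : ∀ x, o (-x) = o x

variable {M : Type*} [AddCommGroup M] {o : M → WithBot ℤ}

theorem IsDegreeLike.add_eq_right (ho : IsDegreeLike o) {x y : M} (h : o x < o y) :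
    o (x + y) = o y := by
  apply le_antisymm
  · exact (ho.add_le x y).trans (max_le h.le le_rfl)
  · by_contra hc
    have h1 := ho.add_le (x + y) (-x)
    rw [ho.neg, show x + y + -x = y by abel] at h1
    exact absurd h1 (not_le.2 (max_lt (not_le.1 hc) h))

theorem IsDegreeLike.add_eq_max (ho : IsDegreeLike o) {x y : M} (h : o x ≠ o y) :
    o (x + y) = max (o x) (o y) := by
  rcases lt_or_gt_of_ne h with h | h
  · rw [ho.add_eq_right h, max_eq_right h.le]
  · rw [add_comm, ho.add_eq_right h, max_eq_left h.le]

/-- Terms of pairwise distinct degrees cannot cancel, so the largest degree survives. Ties are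
tolerated only at `⊥`, which in the applications means among zero terms. -/
theorem IsDegreeLike.sum (ho : IsDegreeLike o) {ι : Type*} (s : Finset ι) (x : ι → M)
    (hx : ∀ i ∈ s, ∀ j ∈ s, i ≠ j → o (x i) ≠ ⊥ → o (x i) ≠ o (x j)) :
    (∀ i ∈ s, o (x i) ≤ o (∑ j ∈ s, x j)) ∧
      (o (∑ j ∈ s, x j) = ⊥ ∨ ∃ i ∈ s, o (∑ j ∈ s, x j) = o (x i)) := by
  classical
  induction s using Finset.induction_on with
  | empty => simp [ho.zero]
  | insert a s ha ih =>
    obtain ⟨h1, h2⟩ := ih fun i hi j hj => hx i (by simp [hi]) j (by simp [hj])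
    rw [Finset.sum_insert ha]
    set T := ∑ j ∈ s, x j
    by_cases hbot : o (x a) = ⊥ ∧ o T = ⊥
    · have h3 : o (x a + T) = ⊥ := by
        have := ho.add_le (x a) T
        simpa [hbot.1, hbot.2] using this
      refine ⟨fun i hi => ?_, Or.inl h3⟩
      rcases Finset.mem_insert.1 hi with rfl | hi
      · simp [hbot.1]
      · have := h1 i hi
        rw [hbot.2] at this
        rw [h3]; exact this
    · have hne : o (x a) ≠ o T := by
        intro he
        rcases h2 with h2 | ⟨i, hi, h2⟩
        · exact hbot ⟨he.trans h2, h2⟩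
        · have hai : a ≠ i := by rintro rfl; exact ha hi
          refine hx a (by simp) i (by simp [hi]) hai (fun h => hbot ⟨h, he ▸ h⟩) (he.trans h2)
      rw [ho.add_eq_max hne]
      refine ⟨fun i hi => ?_, ?_⟩
      · rcases Finset.mem_insert.1 hi with rfl | hi
        · exact le_max_left _ _
        · exact (h1 i hi).trans (le_max_right _ _)
      · rcases le_total (o (x a)) (o T) with h | h
        · rw [max_eq_right h]
          rcases h2 with h2 | ⟨i, hi, h2⟩
          · exact Or.inl h2
          · exact Or.inr ⟨i, by simp [hi], h2⟩
        · rw [max_eq_left h]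
          exact Or.inr ⟨a, by simp, rfl⟩

end Ultrametric

/-! ### Pole orders at `Q` -/

namespace PointedCurve

variable {K F : Type*} [Field K] [Field F] [Algebra K F] {n : ℕ} (X : PointedCurve K F n)

/-- `-v_Q(f) ≤ m`. -/
def PoleLE (f : F) (m : ℤ) : Prop := f ≠ 0 → X.poleOrd f ≤ m

theorem vQ_eq {f : F} (hf : f ≠ 0) : X.vQ f = ((-X.poleOrd f : ℤ) : WithTop ℤ) := by
  have h : X.vQ f ≠ ⊤ := (X.vQ.ne_top_iff).2 hf
  obtain ⟨k, hk⟩ := WithTop.ne_top_iff_exists.1 h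
  simp [poleOrd, ← hk]

theorem poleOrd_eq_of_vQ {f : F} {m : ℤ} (h : X.vQ f = ((-m : ℤ) : WithTop ℤ)) :
    f ≠ 0 ∧ X.poleOrd f = m := by
  constructor
  · rintro rfl
    rw [X.vQ.map_zero] at h
    exact WithTop.coe_ne_top h.symm
  · rw [poleOrd, h, WithTop.untopD_coe, neg_neg]

theorem poleLE_iff {f : F} {m : ℤ} : X.PoleLE f m ↔ ((-m : ℤ) : WithTop ℤ) ≤ X.vQ f := by
  by_cases hf : f = 0
  · simp [PoleLE, hf]
  · rw [X.vQ_eq hf, WithTop.coe_le_coe]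
    simp [PoleLE, hf]

theorem poleOrd_mul {f g : F} (hf : f ≠ 0) (hg : g ≠ 0) :
    X.poleOrd (f * g) = X.poleOrd f + X.poleOrd g := by
  refine (X.poleOrd_eq_of_vQ ?_).2
  rw [X.vQ.map_mul, X.vQ_eq hf, X.vQ_eq hg, ← WithTop.coe_add]
  congr 1; ring

theorem poleOrd_one : X.poleOrd (1 : F) = 0 := by
  have := X.poleOrd_mul (one_ne_zero (α := F)) one_ne_zero
  simp at this; exact this

theorem poleOrd_pow {f : F} (hf : f ≠ 0) (k : ℕ) : X.poleOrd (f ^ k) = k * X.poleOrd f := by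
  induction k with
  | zero => simp [X.poleOrd_one]
  | succ k ih => rw [pow_succ, X.poleOrd_mul (pow_ne_zero _ hf) hf, ih]; push_cast; ring

theorem poleOrd_inv {f : F} (hf : f ≠ 0) : X.poleOrd f⁻¹ = -X.poleOrd f := by
  have := X.poleOrd_mul hf (inv_ne_zero hf)
  rw [mul_inv_cancel₀ hf, X.poleOrd_one] at this
  linarith

theorem poleOrd_neg (f : F) : X.poleOrd (-f) = X.poleOrd f := by
  simp [poleOrd]

theorem mem_Q_iff {f : F} : f ∈ X.Q ↔ X.PoleLE f 0 := by
  rw [X.poleLE_iff, ← X.vQ_nonneg_iff]; simp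

theorem mem_nonunits_Q_iff {f : F} : f ∈ X.Q.nonunits ↔ X.PoleLE f (-1) := by
  rw [ValuationSubring.mem_nonunits_iff_or, X.mem_Q_iff]
  by_cases hf : f = 0
  · simp [hf, PoleLE]
  · simp only [PoleLE, hf, ne_eq, inv_eq_zero, not_false_eq_true, forall_true_left, false_or,
      X.poleOrd_inv hf]
    omega

theorem poleOrd_algebraMap {c : K} (hc : c ≠ 0) : X.poleOrd (algebraMap K F c) = 0 := by
  have h : ∀ d : K, d ≠ 0 → X.poleOrd (algebraMap K F d) ≤ 0 := fun d hd =>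
    X.mem_Q_iff.1 (X.isPlace_Q.2 d) (by simpa using hd)
  have h1 := h c hc
  have h2 := h c⁻¹ (inv_ne_zero hc)
  rw [map_inv₀, X.poleOrd_inv (by simpa using hc)] at h2
  linarith

variable {X}

theorem PoleLE.zero (m : ℤ) : X.PoleLE 0 m := fun h => absurd rfl h

theorem PoleLE.mono {f : F} {m m' : ℤ} (h : X.PoleLE f m) (hm : m ≤ m') : X.PoleLE f m' :=
  fun hf => (h hf).trans hm

theorem PoleLE.add {f g : F} {m : ℤ} (hf : X.PoleLE f m) (hg : X.PoleLE g m) :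
    X.PoleLE (f + g) m := by
  rw [X.poleLE_iff] at *
  exact X.vQ.map_le_add hf hg

theorem PoleLE.neg {f : F} {m : ℤ} (hf : X.PoleLE f m) : X.PoleLE (-f) m := by
  rw [X.poleLE_iff] at *
  simpa using hf

theorem PoleLE.sub {f g : F} {m : ℤ} (hf : X.PoleLE f m) (hg : X.PoleLE g m) :
    X.PoleLE (f - g) m := by
  rw [sub_eq_add_neg]; exact hf.add hg.neg

theorem PoleLE.mul {f g : F} {m m' : ℤ} (hf : X.PoleLE f m) (hg : X.PoleLE g m') :
    X.PoleLE (f * g) (m + m') := fun h => by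
  have h1 := left_ne_zero_of_mul h
  have h2 := right_ne_zero_of_mul h
  rw [X.poleOrd_mul h1 h2]
  exact add_le_add (hf h1) (hg h2)

theorem poleLE_algebraMap (c : K) : X.PoleLE (algebraMap K F c) 0 := fun h => by
  rw [X.poleOrd_algebraMap (by rintro rfl; simp at h)]

theorem PoleLE.const_mul {f : F} {m : ℤ} (c : K) (hf : X.PoleLE f m) :
    X.PoleLE (algebraMap K F c * f) m := by
  simpa using (poleLE_algebraMap c).mul hf

theorem PoleLE.sum {ι : Type*} {s : Finset ι} {f : ι → F} {m : ℤ}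
    (hf : ∀ i ∈ s, X.PoleLE (f i) m) : X.PoleLE (∑ i ∈ s, f i) m := by
  classical
  induction s using Finset.induction_on with
  | empty => simpa using PoleLE.zero m
  | insert a s ha ih =>
    rw [Finset.sum_insert ha]
    exact (hf a (by simp)).add (ih fun i hi => hf i (by simp [hi]))

theorem poleLE_self (f : F) : X.PoleLE f (X.poleOrd f) := fun _ => le_rfl

/-- Adding terms of smaller pole order changes neither the pole order nor non-vanishing. -/
theorem poleOrd_add_of_poleLE {f g : F} (hf : f ≠ 0) (hg : X.PoleLE g (X.poleOrd f - 1)) :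
    f + g ≠ 0 ∧ X.poleOrd (f + g) = X.poleOrd f := by
  have key : ¬ X.PoleLE (f + g) (X.poleOrd f - 1) := fun h => by
    have h2 := h.sub hg
    rw [add_sub_cancel_right] at h2
    linarith [h2 hf]
  have h1 : X.PoleLE (f + g) (X.poleOrd f) := (poleLE_self f).add (hg.mono (by linarith))
  have hne : f + g ≠ 0 := fun h => key (h ▸ PoleLE.zero _)
  refine ⟨hne, le_antisymm (h1 hne) ?_⟩
  by_contra hc
  exact key fun _ => by omega

theorem poleOrd_eq_of_sub {f g : F} (hf : f ≠ 0) (hg : X.PoleLE (g - f) (X.poleOrd f - 1)) :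
    g ≠ 0 ∧ X.poleOrd g = X.poleOrd f := by
  have := poleOrd_add_of_poleLE hf hg
  simpa using this

/-- The degree-like function `k (-v_Q) + l`. -/
def affDeg (X : PointedCurve K F n) (k l : ℤ) (f : F) : WithBot ℤ :=
  open Classical in if f = 0 then ⊥ else ((k * X.poleOrd f + l : ℤ) : WithBot ℤ)

theorem affDeg_of_ne {k l : ℤ} {f : F} (hf : f ≠ 0) :
    X.affDeg k l f = ((k * X.poleOrd f + l : ℤ) : WithBot ℤ) := by simp [affDeg, hf]

theorem affDeg_eq_bot {k l : ℤ} {f : F} : X.affDeg k l f = ⊥ ↔ f = 0 := by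
  by_cases hf : f = 0
  · simp [affDeg, hf]
  · simp only [affDeg_of_ne hf, hf, iff_false]
    exact WithBot.coe_ne_bot

theorem affDeg_le_iff {k l : ℤ} (hk : 0 < k) {f : F} {m : ℤ} :
    X.affDeg k l f ≤ ((k * m + l : ℤ) : WithBot ℤ) ↔ X.PoleLE f m := by
  by_cases hf : f = 0
  · simp [affDeg, hf, PoleLE]
  · rw [affDeg_of_ne hf, WithBot.coe_le_coe]
    simp [PoleLE, hf, hk]

theorem isDegreeLike_affDeg {k : ℤ} (hk : 0 < k) (l : ℤ) : IsDegreeLike (X.affDeg k l) where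
  zero := affDeg_eq_bot.2 rfl
  neg x := by
    by_cases hx : x = 0
    · rw [hx, neg_zero]
    · rw [affDeg_of_ne hx, affDeg_of_ne (neg_ne_zero.2 hx), X.poleOrd_neg]
  add_le x y := by
    by_cases hx : x = 0
    · simp [hx]
    by_cases hy : y = 0
    · simp [hy]
    have h : X.affDeg k l (x + y) ≤
        ((k * max (X.poleOrd x) (X.poleOrd y) + l : ℤ) : WithBot ℤ) :=
      (affDeg_le_iff hk).2 (((poleLE_self x).mono (le_max_left _ _)).add
        ((poleLE_self y).mono (le_max_right _ _)))
    refine h.trans ?_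
    rw [affDeg_of_ne hx, affDeg_of_ne hy]
    rcases le_total (X.poleOrd x) (X.poleOrd y) with h | h
    · rw [max_eq_right h]; exact le_max_right _ _
    · rw [max_eq_left h]; exact le_max_left _ _

/-! ### The ring of functions regular outside `Q` -/

variable (X)

/-- `𝓛(∞Q)` as a subalgebra. -/
def ring : Subalgebra K F where
  carrier := X.LInf
  add_mem' hf hg V h1 h2 := V.add_mem _ _ (hf V h1 h2) (hg V h1 h2)
  mul_mem' hf hg V h1 h2 := V.mul_mem _ _ (hf V h1 h2) (hg V h1 h2)
  algebraMap_mem' c _ h1 _ := h1.2 c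

/-- An integrally closed subring is an intersection of valuation rings. If `f` were not integral, a
valuation ring containing the integral closure of `K` would omit `f`; it would be a place, but `f`
is regular at `Q` and at every other place. -/
theorem isIntegral_of_mem_ring {f : F} (hf : f ∈ X.ring) (h0 : X.PoleLE f 0) :
    IsIntegral K f := by
  by_contra hc
  have hR : f ∉ (integralClosure K F).toSubring := hc
  have : IsIntegrallyClosedIn (integralClosure K F).toSubring F :=
    inferInstanceAs (IsIntegrallyClosedIn (integralClosure K F) F)
  obtain ⟨V, hV, hfV⟩ := Subring.exists_le_valuationSubring_of_isIntegrallyClosedIn hR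
  have hpl : IsPlace K V := by
    refine ⟨?_, fun c => hV (integralClosure K F |>.algebraMap_mem c)⟩
    rintro rfl
    exact hfV (ValuationSubring.mem_top f)
  by_cases hVQ : V = X.Q
  · subst hVQ
    exact hfV (X.mem_Q_iff.2 h0)
  · exact hfV (hf V hpl hVQ)

/-- Otherwise `f` is integral over the field `K`, so its inverse already lies in every `K`-algebra
containing `f`, in particular in the valuation ring of `Q`. But the inverse of a function with a
zero at `Q` has a pole there. -/
theorem eq_zero_of_poleLE_neg {f : F} (hf : f ∈ X.ring) {m : ℤ} (hm : m < 0)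
    (h0 : X.PoleLE f m) : f = 0 := by
  by_contra hne
  have hint := X.isIntegral_of_mem_ring hf (h0.mono hm.le)
  let S : Subalgebra K F :=
    { X.Q.toSubring with algebraMap_mem' := fun c => X.isPlace_Q.2 c }
  have hfS : f ∈ S := X.mem_Q_iff.2 (h0.mono hm.le)
  have hinv : f⁻¹ ∈ S := hint.inv_mem hfS
  have h1 := X.mem_Q_iff.1 (show f⁻¹ ∈ X.Q from hinv) (inv_ne_zero hne)
  rw [X.poleOrd_inv hne] at h1
  have := h0 hne
  linarith

theorem poleOrd_nonneg {f : F} (hf : f ∈ X.ring) : 0 ≤ X.poleOrd f := by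
  by_cases h : f = 0
  · simp [h, poleOrd]
  by_contra hc
  exact h (X.eq_zero_of_poleLE_neg hf (not_le.1 hc) (poleLE_self f))

theorem mem_H_of_poleOrd {f : F} (hf : f ∈ X.ring) (h0 : f ≠ 0) {m : ℕ} (hm : X.poleOrd f = m) :
    m ∈ X.H := ⟨f, hf, by rw [X.vQ_eq h0, hm]⟩

/-- The quotient `f / g` is regular at `Q`, hence congruent to a constant because `Q` has degree
one. This is the reduction step of every division argument below. -/
theorem exists_sub_poleLE {f g : F} (hg : g ≠ 0) (h : X.PoleLE f (X.poleOrd g)) :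
    ∃ c : K, X.PoleLE (f - algebraMap K F c * g) (X.poleOrd g - 1) := by
  have h1 : f / g ∈ X.Q := by
    rw [X.mem_Q_iff, div_eq_mul_inv]
    have := h.mul (poleLE_self (X := X) g⁻¹)
    rwa [X.poleOrd_inv hg, add_neg_cancel] at this
  obtain ⟨c, hc⟩ := X.isDegreeOne_Q _ h1
  refine ⟨c, ?_⟩
  have := (X.mem_nonunits_Q_iff.1 hc).mul (poleLE_self (X := X) g)
  rw [sub_mul, div_mul_cancel₀ _ hg] at this
  exact this.mono (by linarith)

/-! ### Evaluation at the places `P_i` -/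

section Evaluation

variable {V : ValuationSubring F}

theorem placeValue_spec (hd : IsDegreeOne K V) {f : F} (hf : f ∈ V) :
    f - algebraMap K F (placeValue K V f) ∈ V.nonunits := by
  have h := hd f hf
  rw [placeValue, dif_pos h]
  exact h.choose_spec

/-- Two candidates differ by a constant in the maximal ideal, and a nonzero constant is a unit. -/
theorem placeValue_unique (hp : IsPlace K V) (hd : IsDegreeOne K V) {f : F} {c : K}
    (hc : f - algebraMap K F c ∈ V.nonunits) : placeValue K V f = c := by
  have hf : f ∈ V := by
    have := V.add_mem _ _ (ValuationSubring.nonunits_subset hc) (hp.2 c)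
    simpa using this
  have h := V.nonunits.sub_mem hc (placeValue_spec hd hf)
  have h2 : f - algebraMap K F c - (f - algebraMap K F (placeValue K V f)) =
      algebraMap K F (placeValue K V f - c) := by rw [map_sub]; ring
  rw [h2, ValuationSubring.mem_nonunits_iff_or] at h
  rcases h with h | h
  · rw [map_eq_zero, sub_eq_zero] at h
    exact h
  · rw [← map_inv₀] at h
    exact absurd (hp.2 _) h

theorem mul_mem_nonunits {f g : F} (hf : f ∈ V) (hg : g ∈ V.nonunits) : f * g ∈ V.nonunits := by
  rw [ValuationSubring.mem_nonunits_iff] at *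
  rw [map_mul]
  exact mul_lt_one_of_nonneg_of_lt_one_right ((V.valuation_le_one_iff f).2 hf) zero_le hg

end Evaluation

variable {X}

theorem mem_P {f : F} (hf : f ∈ X.ring) (i : Fin n) : f ∈ X.P i :=
  hf _ (X.isPlace_P i) (X.P_ne_Q i)

theorem ev_spec {f : F} (hf : f ∈ X.ring) (i : Fin n) :
    f - algebraMap K F (X.ev f i) ∈ (X.P i).nonunits :=
  placeValue_spec (X.isDegreeOne_P i) (mem_P hf i)

theorem ev_unique {f : F} {i : Fin n} {c : K}
    (hc : f - algebraMap K F c ∈ (X.P i).nonunits) : X.ev f i = c :=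
  placeValue_unique (X.isPlace_P i) (X.isDegreeOne_P i) hc

theorem ev_add {f g : F} (hf : f ∈ X.ring) (hg : g ∈ X.ring) :
    X.ev (f + g) = X.ev f + X.ev g := by
  ext i
  apply ev_unique
  have := (X.P i).nonunits.add_mem (ev_spec hf i) (ev_spec hg i)
  simp only [Pi.add_apply, map_add]
  convert this using 1; ring

theorem ev_mul {f g : F} (hf : f ∈ X.ring) (hg : g ∈ X.ring) :
    X.ev (f * g) = X.ev f * X.ev g := by
  ext i
  apply ev_unique
  have h1 := mul_mem_nonunits (mem_P hf i) (ev_spec hg i)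
  have h2 := mul_mem_nonunits ((X.isPlace_P i).2 (X.ev g i)) (ev_spec hf i)
  have := (X.P i).nonunits.add_mem h1 h2
  simp only [Pi.mul_apply, map_mul]
  convert this using 1; ring

theorem ev_algebraMap (c : K) : X.ev (algebraMap K F c) = fun _ => c := by
  ext i
  exact ev_unique (by simp)

theorem ev_const_mul {f : F} (hf : f ∈ X.ring) (c : K) :
    X.ev (algebraMap K F c * f) = c • X.ev f := by
  rw [ev_mul (X.ring.algebraMap_mem c) hf, ev_algebraMap]
  rfl

theorem mem_LMinusD_iff {f : F} (hf : f ∈ X.ring) : f ∈ X.LMinusD ↔ X.ev f = 0 := by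
  constructor
  · intro h
    ext i
    exact ev_unique (by simpa using h.2 i)
  · intro h
    refine ⟨hf, fun i => ?_⟩
    have := ev_spec hf i
    simpa [h] using this

variable (X) in
/-- Evaluation at `P_1, …, P_n` as a linear map on `𝓛(∞Q)`. -/
def evHom : X.ring →ₗ[K] (Fin n → K) where
  toFun f := X.ev f
  map_add' f g := ev_add f.2 g.2
  map_smul' c f := by
    simp only [Algebra.smul_def, RingHom.id_apply]
    exact ev_const_mul f.2 c

theorem ev_sub {f g : F} (hf : f ∈ X.ring) (hg : g ∈ X.ring) :
    X.ev (f - g) = X.ev f - X.ev g := X.evHom.map_sub ⟨f, hf⟩ ⟨g, hg⟩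

theorem ev_neg {f : F} (hf : f ∈ X.ring) : X.ev (-f) = -X.ev f := X.evHom.map_neg ⟨f, hf⟩

end PointedCurve

/-! ### The `K[x_1]`-basis `y_0, …, y_{a_1-1}` of `𝓛(∞Q)` -/

namespace StandardForm

open PointedCurve

variable {K F : Type*} [Field K] [Field F] [Algebra K F] {n : ℕ} {X : PointedCurve K F n} {t : ℕ}
  (S : StandardForm X t)

theorem a1_pos : 0 < S.a1 := S.a_pos 0

theorem x1_mem : S.x1 ∈ X.ring := S.x_mem 0

theorem x_ne_zero (j : Fin (t + 1)) : S.x j ≠ 0 := (X.poleOrd_eq_of_vQ (S.x_pole j)).1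

theorem poleOrd_x (j : Fin (t + 1)) : X.poleOrd (S.x j) = S.a j :=
  (X.poleOrd_eq_of_vQ (S.x_pole j)).2

theorem x1_ne_zero : S.x1 ≠ 0 := S.x_ne_zero 0

theorem poleOrd_x1 : X.poleOrd S.x1 = S.a1 := S.poleOrd_x 0

theorem b_mod {i : ℕ} (hi : i < S.a1) : S.b i % S.a1 = i := (S.b_least i hi).1.2

theorem b_le {m : ℕ} (hm : m ∈ X.H) : S.b (m % S.a1) ≤ m :=
  (S.b_least _ (Nat.mod_lt _ S.a1_pos)).2 ⟨hm, rfl⟩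

theorem eq_b_add {m : ℕ} (hm : m ∈ X.H) :
    m = S.b (m % S.a1) + S.a1 * ((m - S.b (m % S.a1)) / S.a1) := by
  have h1 := S.b_le hm
  have h2 : S.a1 ∣ m - S.b (m % S.a1) :=
    (Nat.modEq_iff_dvd' h1).1 (S.b_mod (Nat.mod_lt _ S.a1_pos))
  rw [Nat.mul_div_cancel' h2]
  omega

theorem y_mem (i : ℕ) : S.y i ∈ X.ring :=
  X.ring.prod_mem fun j _ => X.ring.pow_mem (S.x_mem j) _

theorem y_ne_zero (i : ℕ) : S.y i ≠ 0 :=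
  Finset.prod_ne_zero_iff.2 fun j _ => pow_ne_zero _ (S.x_ne_zero j)

theorem poleOrd_y {i : ℕ} (hi : i < S.a1) : X.poleOrd (S.y i) = S.b i := by
  classical
  rw [← S.expo_weight i hi, expWeight, y]
  have : ∀ s : Finset (Fin (t + 1)), X.poleOrd (∏ j ∈ s, S.x j ^ S.expo i j) =
      ((∑ j ∈ s, S.a j * S.expo i j : ℕ) : ℤ) := by
    intro s
    induction s using Finset.induction_on with
    | empty => simp [X.poleOrd_one]
    | insert a s ha ih =>
      rw [Finset.prod_insert ha, X.poleOrd_mul (pow_ne_zero _ (S.x_ne_zero a))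
        (Finset.prod_ne_zero_iff.2 fun j _ => pow_ne_zero _ (S.x_ne_zero j)), ih,
        X.poleOrd_pow (S.x_ne_zero a), Finset.sum_insert ha, S.poleOrd_x]
      push_cast
      ring
  exact this _

theorem φ_mem (s : ℕ) : S.φ s ∈ X.ring :=
  X.ring.mul_mem (X.ring.pow_mem S.x1_mem _) (S.y_mem _)

theorem φ_ne_zero (s : ℕ) : S.φ s ≠ 0 :=
  mul_ne_zero (pow_ne_zero _ S.x1_ne_zero) (S.y_ne_zero _)

theorem x1_pow_mul_y {i : ℕ} (hi : i < S.a1) (k : ℕ) :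
    S.x1 ^ k * S.y i = S.φ (S.b i + S.a1 * k) := by
  have h1 : (S.b i + S.a1 * k) % S.a1 = i := by
    rw [Nat.add_mul_mod_self_left, S.b_mod hi]
  rw [φ, h1, Nat.add_sub_cancel_left, Nat.mul_div_cancel_left _ S.a1_pos]

theorem poleOrd_φ {s : ℕ} (hs : s ∈ X.H) : X.poleOrd (S.φ s) = s := by
  rw [φ, X.poleOrd_mul (pow_ne_zero _ S.x1_ne_zero) (S.y_ne_zero _),
    X.poleOrd_pow S.x1_ne_zero, S.poleOrd_x1, S.poleOrd_y (Nat.mod_lt _ S.a1_pos)]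
  conv_rhs => rw [S.eq_b_add hs]
  push_cast
  ring

theorem add_mem_H (S : StandardForm X t) {s s' : ℕ} (hs : s ∈ X.H) (hs' : s' ∈ X.H) : s + s' ∈ X.H :=
  X.mem_H_of_poleOrd (X.ring.mul_mem (S.φ_mem s) (S.φ_mem s'))
    (mul_ne_zero (S.φ_ne_zero s) (S.φ_ne_zero s'))
    (by rw [X.poleOrd_mul (S.φ_ne_zero s) (S.φ_ne_zero s'), S.poleOrd_φ hs, S.poleOrd_φ hs']
        push_cast; rfl)

theorem x1_pow_mul_φ {s : ℕ} (hs : s ∈ X.H) (k : ℕ) :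
    S.x1 ^ k * S.φ s = S.φ (s + S.a1 * k) := by
  have hi := Nat.mod_lt s S.a1_pos
  have h : s + S.a1 * k = S.b (s % S.a1) + S.a1 * ((s - S.b (s % S.a1)) / S.a1 + k) := by
    conv_lhs => rw [S.eq_b_add hs]
    ring
  rw [h, ← S.x1_pow_mul_y hi, φ, pow_add]
  ring

theorem aeval_mem (p : K[X]) : aeval S.x1 p ∈ X.ring := by
  have := (aeval (⟨S.x1, S.x1_mem⟩ : X.ring) p).2
  rwa [← Subalgebra.coe_val X.ring, ← Polynomial.aeval_algHom_apply] at this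

theorem poleLE_aeval (p : K[X]) {k : ℕ} (hp : p.natDegree ≤ k) :
    X.PoleLE (aeval S.x1 p) (S.a1 * k) := by
  rw [aeval_eq_sum_range]
  refine PoleLE.sum fun i hi => ?_
  rw [Algebra.smul_def]
  refine PoleLE.const_mul _ fun _ => ?_
  rw [X.poleOrd_pow S.x1_ne_zero, S.poleOrd_x1, mul_comm]
  have : i ≤ k := (Nat.lt_succ_iff.1 (Finset.mem_range.1 hi)).trans hp
  gcongr

theorem poleOrd_aeval {p : K[X]} (hp : p ≠ 0) :
    aeval S.x1 p ≠ 0 ∧ X.poleOrd (aeval S.x1 p) = S.a1 * p.natDegree := by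
  have hlead : X.poleOrd (algebraMap K F p.leadingCoeff * S.x1 ^ p.natDegree) =
      S.a1 * p.natDegree := by
    rw [X.poleOrd_mul (by simpa using hp) (pow_ne_zero _ S.x1_ne_zero),
      X.poleOrd_algebraMap (by simpa using hp), X.poleOrd_pow S.x1_ne_zero, S.poleOrd_x1]
    ring
  have hne : algebraMap K F p.leadingCoeff * S.x1 ^ p.natDegree ≠ 0 :=
    mul_ne_zero (by simpa using hp) (pow_ne_zero _ S.x1_ne_zero)
  rw [← hlead]
  refine poleOrd_eq_of_sub hne ?_
  rw [hlead]
  have h1 : aeval S.x1 p - algebraMap K F p.leadingCoeff * S.x1 ^ p.natDegree =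
      aeval S.x1 p.eraseLead := by
    rw [← p.self_sub_C_mul_X_pow, map_sub, map_mul, aeval_C, map_pow, aeval_X]
  rw [h1]
  by_cases he : p.eraseLead = 0
  · rw [he, map_zero]; exact PoleLE.zero _
  · have h2 : p.eraseLead.natDegree + 1 ≤ p.natDegree := by
      have := eraseLead_natDegree_le p
      have h3 : 0 < p.natDegree := by
        by_contra h0
        apply he
        rw [eq_C_of_natDegree_eq_zero (Nat.eq_zero_of_not_pos h0), eraseLead_C]
      omega
    refine (S.poleLE_aeval _ le_rfl).mono ?_
    have h4 : (S.a1 : ℤ) * (p.eraseLead.natDegree + 1) ≤ S.a1 * p.natDegree := by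
      gcongr; exact_mod_cast h2
    have := S.a1_pos
    have : (1 : ℤ) ≤ S.a1 := by exact_mod_cast this
    linarith

theorem aeval_eq_zero_iff {p : K[X]} : aeval S.x1 p = 0 ↔ p = 0 :=
  ⟨fun h => by_contra fun hp => (S.poleOrd_aeval hp).1 h, fun h => by simp [h]⟩

theorem poleOrd_aeval_mod (p : K[X]) (m : ℤ) :
    (X.poleOrd (aeval S.x1 p) + m) % (S.a1 : ℤ) = m % S.a1 := by
  by_cases hp : p = 0
  · simp [hp, poleOrd]
  · rw [(S.poleOrd_aeval hp).2]; simp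

theorem poleOrd_aeval_mul_y {p : K[X]} (hp : p ≠ 0) {j : ℕ} (hj : j < S.a1) :
    aeval S.x1 p * S.y j ≠ 0 ∧
      X.poleOrd (aeval S.x1 p * S.y j) = S.a1 * p.natDegree + S.b j := by
  obtain ⟨h1, h2⟩ := S.poleOrd_aeval hp
  refine ⟨mul_ne_zero h1 (S.y_ne_zero j), ?_⟩
  rw [X.poleOrd_mul h1 (S.y_ne_zero j), h2, S.poleOrd_y hj]

theorem poleOrd_aeval_mul_y_mod {p : K[X]} (hp : p ≠ 0) {j : ℕ} (hj : j < S.a1) :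
    X.poleOrd (aeval S.x1 p * S.y j) % (S.a1 : ℤ) = j := by
  rw [(S.poleOrd_aeval_mul_y hp hj).2, Int.mul_add_emod_self_left]
  exact_mod_cast S.b_mod hj

/-- The combination `∑ p_j(x_1) y_j`. -/
def expand (p : ℕ → K[X]) : F := ∑ j ∈ Finset.range S.a1, aeval S.x1 (p j) * S.y j

theorem expand_mem (p : ℕ → K[X]) : S.expand p ∈ X.ring :=
  X.ring.sum_mem fun _ _ => X.ring.mul_mem (S.aeval_mem _) (S.y_mem _)

theorem expand_add (p q : ℕ → K[X]) : S.expand (p + q) = S.expand p + S.expand q := by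
  simp [expand, add_mul, Finset.sum_add_distrib]

/-- Nonzero terms with different `j` have pole orders in different classes modulo `a_1`, so they
cannot cancel. -/
theorem affDeg_expand {k : ℤ} (hk : 0 < k) (l : ℤ) (p : ℕ → K[X]) :
    (∀ i ∈ Finset.range S.a1, X.affDeg k l (aeval S.x1 (p i) * S.y i) ≤ X.affDeg k l (S.expand p)) ∧
      (X.affDeg k l (S.expand p) = ⊥ ∨ ∃ i ∈ Finset.range S.a1,
        X.affDeg k l (S.expand p) = X.affDeg k l (aeval S.x1 (p i) * S.y i)) := by
  refine (isDegreeLike_affDeg hk l).sum _ _ fun i hi j hj hij hbot heq => hij ?_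
  have hi' := Finset.mem_range.1 hi
  have hj' := Finset.mem_range.1 hj
  have hpi : p i ≠ 0 := by
    rintro h; apply hbot; simp [h, affDeg]
  have hpj : p j ≠ 0 := by
    rintro h; apply hbot; rw [heq]; simp [h, affDeg]
  rw [affDeg_of_ne (S.poleOrd_aeval_mul_y hpi hi').1,
    affDeg_of_ne (S.poleOrd_aeval_mul_y hpj hj').1, WithBot.coe_inj] at heq
  have h1 : X.poleOrd (aeval S.x1 (p i) * S.y i) = X.poleOrd (aeval S.x1 (p j) * S.y j) := by
    have := add_right_cancel heq
    exact mul_left_cancel₀ hk.ne' this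
  have h2 := S.poleOrd_aeval_mul_y_mod hpi hi'
  rw [h1, S.poleOrd_aeval_mul_y_mod hpj hj'] at h2
  exact_mod_cast h2.symm

theorem expand_eq_zero {p : ℕ → K[X]} (h : S.expand p = 0) {j : ℕ} (hj : j < S.a1) : p j = 0 := by
  have h1 := (S.affDeg_expand one_pos 0 p).1 j (Finset.mem_range.2 hj)
  rw [h, (isDegreeLike_affDeg one_pos 0).zero, le_bot_iff, affDeg_eq_bot, mul_eq_zero] at h1
  exact S.aeval_eq_zero_iff.1 (h1.resolve_right (S.y_ne_zero j))

theorem expand_single {j : ℕ} (hj : j < S.a1) (p : K[X]) :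
    S.expand (Pi.single j p) = aeval S.x1 p * S.y j := by
  rw [expand, Finset.sum_eq_single j]
  · simp
  · intro i _ hij; simp [hij]
  · intro h; exact absurd (Finset.mem_range.2 hj) h

/-- The pole order `m` of a nonzero function is a nongap, so subtracting a multiple of `φ_m` lowers
it. The bound `m - 1` makes the induction start at negative pole order, where only `0` remains. -/
theorem exists_expand {f : F} (hf : f ∈ X.ring) : ∃ p : ℕ → K[X], f = S.expand p := by
  have key : ∀ (m : ℕ) (f : F), f ∈ X.ring → X.PoleLE f (m - 1) → ∃ p : ℕ → K[X], f = S.expand p := by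
    intro m
    induction m with
    | zero =>
      intro f hf h
      exact ⟨0, by rw [X.eq_zero_of_poleLE_neg hf (by norm_num) h]; simp [expand]⟩
    | succ m ih =>
      intro f hf h
      by_cases hm : X.PoleLE f (m - 1)
      · exact ih f hf hm
      have h0 : f ≠ 0 := fun h0 => hm (h0 ▸ PoleLE.zero _)
      have hp : X.poleOrd f = m := by
        have h1 := h h0
        have h2 : ¬ X.poleOrd f ≤ m - 1 := fun h => hm fun _ => h
        push_cast at h1
        omega
      have hmH := X.mem_H_of_poleOrd hf h0 hp
      obtain ⟨c, hc⟩ := X.exists_sub_poleLE (f := f) (S.φ_ne_zero m)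
        (by rw [S.poleOrd_φ hmH, ← hp]; exact poleLE_self f)
      rw [S.poleOrd_φ hmH] at hc
      obtain ⟨p, hp⟩ := ih _ (X.ring.sub_mem hf
        (X.ring.mul_mem (X.ring.algebraMap_mem c) (S.φ_mem m))) hc
      refine ⟨p + Pi.single (m % S.a1) (C c * Polynomial.X ^ ((m - S.b (m % S.a1)) / S.a1)), ?_⟩
      rw [S.expand_add, ← hp, S.expand_single (Nat.mod_lt _ S.a1_pos)]
      simp [φ, mul_assoc]
  refine key ((X.poleOrd f).toNat + 1) f hf ((poleLE_self f).mono ?_)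
  push_cast
  have := Int.self_le_toNat (X.poleOrd f)
  linarith

theorem expand_coord {f : F} (hf : f ∈ X.ring) : S.expand (S.coord f) = f := by
  have h : ∃ p : ℕ → K[X], f = ∑ j ∈ Finset.range S.a1, aeval S.x1 (p j) * S.y j :=
    S.exists_expand hf
  rw [coord, dif_pos h]
  exact h.choose_spec.symm

theorem poleLE_coord_term {f : F} (hf : f ∈ X.ring) {m : ℤ} (hm : X.PoleLE f m) {j : ℕ}
    (hj : j < S.a1) : X.PoleLE (aeval S.x1 (S.coord f j) * S.y j) m := by
  have h1 := (S.affDeg_expand one_pos 0 (S.coord f)).1 j (Finset.mem_range.2 hj)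
  rw [S.expand_coord hf] at h1
  exact (affDeg_le_iff one_pos).1 (h1.trans ((affDeg_le_iff one_pos).2 hm))

theorem poleLE_coord_term_of_ne {f : F} (hf : f ∈ X.ring) {m : ℤ} (hm : X.PoleLE f m) {j : ℕ}
    (hj : j < S.a1) (hne : m % (S.a1 : ℤ) ≠ j) :
    X.PoleLE (aeval S.x1 (S.coord f j) * S.y j) (m - 1) := fun h => by
  have hp : S.coord f j ≠ 0 := by
    rintro h0; exact h (by simp [h0])
  have h1 := S.poleLE_coord_term hf hm hj h
  have h2 := S.poleOrd_aeval_mul_y_mod hp hj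
  rcases lt_or_eq_of_le h1 with h3 | h3
  · omega
  · rw [h3] at h2; exact absurd h2 hne

/-- Only the term in the class of `m` modulo `a_1` can reach pole order `m`. -/
theorem poleLE_sub_coord_term {f : F} (hf : f ∈ X.ring) {m : ℤ} (hm : X.PoleLE f m) {j : ℕ}
    (hj : j < S.a1) (hmj : m % (S.a1 : ℤ) = j) :
    X.PoleLE (f - aeval S.x1 (S.coord f j) * S.y j) (m - 1) := by
  have : f - aeval S.x1 (S.coord f j) * S.y j =
      ∑ i ∈ (Finset.range S.a1).erase j, aeval S.x1 (S.coord f i) * S.y i := by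
    have h := S.expand_coord hf
    rw [expand, ← Finset.add_sum_erase _ _ (Finset.mem_range.2 hj)] at h
    rw [sub_eq_iff_eq_add', h]
  rw [this]
  refine PoleLE.sum fun i hi => ?_
  rw [Finset.mem_erase, Finset.mem_range] at hi
  refine S.poleLE_coord_term_of_ne hf hm hi.2 ?_
  rw [hmj]
  exact_mod_cast hi.1.symm

/-! ### Top coefficients -/

/-- The coefficient of `φ_d` in `f` is `c`, and `-v_Q(f) ≤ d`. -/
def TopCoeff (d : ℕ) (c : K) (f : F) : Prop := X.PoleLE (f - algebraMap K F c * S.φ d) (d - 1)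

section TopCoeff

variable {S} {d : ℕ} {c c' : K} {f f' : F}

theorem TopCoeff.add (h : S.TopCoeff d c f) (h' : S.TopCoeff d c' f') :
    S.TopCoeff d (c + c') (f + f') := by
  have := PoleLE.add h h'
  unfold TopCoeff
  convert this using 1
  rw [map_add]; ring

theorem TopCoeff.const_mul (h : S.TopCoeff d c f) (r : K) :
    S.TopCoeff d (r * c) (algebraMap K F r * f) := by
  have := PoleLE.const_mul r h
  unfold TopCoeff
  convert this using 1
  rw [map_mul]; ring

theorem TopCoeff.sub (h : S.TopCoeff d c f) (h' : S.TopCoeff d c' f') :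
    S.TopCoeff d (c - c') (f - f') := by
  have := PoleLE.sub h h'
  unfold TopCoeff
  convert this using 1
  rw [map_sub]; ring

theorem TopCoeff.x1_pow_mul (hd : d ∈ X.H) (h : S.TopCoeff d c f) (k : ℕ) :
    S.TopCoeff (d + S.a1 * k) c (S.x1 ^ k * f) := by
  have := (poleLE_self (X := X) (S.x1 ^ k)).mul h
  rw [X.poleOrd_pow S.x1_ne_zero, S.poleOrd_x1] at this
  unfold TopCoeff
  rw [← S.x1_pow_mul_φ hd]
  convert this using 1
  · ring
  · push_cast; ring

theorem topCoeff_zero_iff : S.TopCoeff d 0 f ↔ X.PoleLE f (d - 1) := by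
  simp [TopCoeff]

theorem TopCoeff.poleOrd (hd : d ∈ X.H) (h : S.TopCoeff d c f) (hc : c ≠ 0) :
    f ≠ 0 ∧ X.poleOrd f = d := by
  have hne : algebraMap K F c * S.φ d ≠ 0 := mul_ne_zero (by simpa using hc) (S.φ_ne_zero d)
  have hp : X.poleOrd (algebraMap K F c * S.φ d) = d := by
    rw [X.poleOrd_mul (by simpa using hc) (S.φ_ne_zero d), X.poleOrd_algebraMap hc,
      S.poleOrd_φ hd, zero_add]
  rw [← hp]
  refine poleOrd_eq_of_sub hne ?_
  rw [hp]
  exact h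

theorem TopCoeff.congr (h : S.TopCoeff d c f) (hs : X.PoleLE (f' - f) (d - 1)) :
    S.TopCoeff d c f' := by
  have := h.add (topCoeff_zero_iff.2 hs)
  simpa using this

theorem topCoeff_aeval_mul_y {p : K[X]} {j k : ℕ} (hj : j < S.a1) (hk : p.natDegree ≤ k)
    (hd : d = S.b j + S.a1 * k) : S.TopCoeff d (p.coeff k) (aeval S.x1 p * S.y j) := by
  unfold TopCoeff
  rw [hd, ← S.x1_pow_mul_y hj]
  have h1 : aeval S.x1 p * S.y j - algebraMap K F (p.coeff k) * (S.x1 ^ k * S.y j) =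
      aeval S.x1 (p - C (p.coeff k) * Polynomial.X ^ k) * S.y j := by
    simp; ring
  rw [h1]
  set q := p - C (p.coeff k) * Polynomial.X ^ k with hq
  by_cases hq0 : q = 0
  · rw [hq0]; simpa using PoleLE.zero _
  intro _
  rw [(S.poleOrd_aeval_mul_y hq0 hj).2]
  have h2 : q.natDegree ≤ k :=
    (natDegree_sub_le _ _).trans (max_le hk (natDegree_C_mul_X_pow_le _ _))
  have h3 : q.coeff k = 0 := by simp [hq]
  have h4 : q.natDegree ≠ k := by
    rintro h4
    apply hq0
    rw [← leadingCoeff_eq_zero, leadingCoeff, h4, h3]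
  have h5 : (q.natDegree : ℤ) + 1 ≤ k := by exact_mod_cast lt_of_le_of_ne h2 h4
  have h6 : (1 : ℤ) ≤ S.a1 := by exact_mod_cast S.a1_pos
  push_cast
  nlinarith

theorem topCoeff_coord (hf : f ∈ X.ring) (hd : d ∈ X.H) (hle : X.PoleLE f d) :
    S.TopCoeff d ((S.coord f (d % S.a1)).coeff ((d - S.b (d % S.a1)) / S.a1)) f := by
  have hj := Nat.mod_lt d S.a1_pos
  refine TopCoeff.congr (topCoeff_aeval_mul_y hj ?_ (S.eq_b_add hd))
    (S.poleLE_sub_coord_term hf hle hj (by push_cast; rfl))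
  by_cases hp : S.coord f (d % S.a1) = 0
  · simp [hp]
  have h1 := S.poleLE_coord_term hf hle hj (S.poleOrd_aeval_mul_y hp hj).1
  rw [(S.poleOrd_aeval_mul_y hp hj).2] at h1
  have h2 : S.a1 * (S.coord f (d % S.a1)).natDegree + S.b (d % S.a1) ≤ d := by exact_mod_cast h1
  rw [Nat.le_div_iff_mul_le S.a1_pos, mul_comm]
  omega

end TopCoeff

theorem coord_lead {f : F} (hf : f ∈ X.ring) (h0 : f ≠ 0) {j : ℕ} (hj : j < S.a1)
    (hmod : X.poleOrd f % (S.a1 : ℤ) = j) :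
    S.coord f j ≠ 0 ∧ X.poleOrd f = S.a1 * (S.coord f j).natDegree + S.b j ∧
      X.PoleLE (f - aeval S.x1 (S.coord f j) * S.y j) (X.poleOrd f - 1) := by
  have h1 := S.poleLE_sub_coord_term hf (poleLE_self f) hj hmod
  have hp : S.coord f j ≠ 0 := by
    intro hp
    rw [hp] at h1
    simp only [map_zero, zero_mul, sub_zero] at h1
    linarith [h1 h0]
  refine ⟨hp, ?_, h1⟩
  rw [← (S.poleOrd_aeval_mul_y hp hj).2]
  refine (poleOrd_eq_of_sub h0 ?_).2.symm
  rw [← neg_sub]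
  exact h1.neg

theorem topCoeff_lc {f : F} (hf : f ∈ X.ring) (h0 : f ≠ 0) {d : ℕ} (hd : X.poleOrd f = d) :
    S.TopCoeff d (S.lc f) f ∧ S.lc f ≠ 0 := by
  have hdH := X.mem_H_of_poleOrd hf h0 hd
  have h1 : S.TopCoeff d (S.lc f) f := by
    have := topCoeff_coord (S := S) hf hdH (fun _ => hd.le)
    simpa only [lc, hd, Int.toNat_natCast] using this
  refine ⟨h1, fun hc => ?_⟩
  rw [hc, topCoeff_zero_iff] at h1
  linarith [h1 h0]

end StandardForm

/-! ### The order `<_s` and the module of relations -/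

namespace PointedCurve

variable {K F : Type*} [Field K] [Field F] [Algebra K F] {n : ℕ} (X : PointedCurve K F n)

/-- The degree on `F z ⊕ F` that belongs to the order `<_s`: monomials `m` and `m z` have the
degrees `2 (-v_Q(m))` and `2 (-v_Q(m) + s) + 1`. -/
def pairDeg (s : ℤ) (e : F × F) : WithBot ℤ := max (X.affDeg 2 0 e.1) (X.affDeg 2 (2 * s + 1) e.2)

variable {X}

theorem isDegreeLike_pairDeg (s : ℤ) : IsDegreeLike (X.pairDeg s) where
  zero := by
    simp [pairDeg, (isDegreeLike_affDeg (X := X) two_pos _).zero]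
  neg x := by
    simp [pairDeg, (isDegreeLike_affDeg (X := X) two_pos _).neg]
  add_le x y := by
    have h1 := (isDegreeLike_affDeg (X := X) two_pos 0).add_le x.1 y.1
    have h2 := (isDegreeLike_affDeg (X := X) two_pos (2 * s + 1)).add_le x.2 y.2
    simp only [pairDeg, Prod.fst_add, Prod.snd_add]
    refine max_le (h1.trans (max_le ?_ ?_)) (h2.trans (max_le ?_ ?_))
    · exact (le_max_left _ _).trans (le_max_left _ _)
    · exact (le_max_left _ _).trans (le_max_right _ _)
    · exact (le_max_right _ _).trans (le_max_left _ _)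
    · exact (le_max_right _ _).trans (le_max_right _ _)

theorem pairDeg_eq_bot {s : ℤ} {e : F × F} : X.pairDeg s e = ⊥ ↔ e = 0 := by
  simp [pairDeg, affDeg_eq_bot, Prod.ext_iff]

variable (X)

/-- The module of all `α₀ + α₁ z` over `𝓛(∞Q)` that vanish at the points `(P_i, v_i)`. -/
def relations (v : Fin n → K) : Submodule X.ring (F × F) where
  carrier := {e | e.1 ∈ X.ring ∧ e.2 ∈ X.ring ∧ X.ev e.1 + X.ev e.2 * v = 0}
  zero_mem' := by
    have h : X.ev (0 : F) = 0 := X.evHom.map_zero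
    simp [h, X.ring.zero_mem]
  add_mem' := by
    rintro a b ⟨h1, h2, h3⟩ ⟨h4, h5, h6⟩
    refine ⟨X.ring.add_mem h1 h4, X.ring.add_mem h2 h5, ?_⟩
    rw [Prod.fst_add, Prod.snd_add, ev_add h1 h4, ev_add h2 h5]
    linear_combination h3 + h6
  smul_mem' := by
    rintro c a ⟨h1, h2, h3⟩
    refine ⟨X.ring.mul_mem c.2 h1, X.ring.mul_mem c.2 h2, ?_⟩
    change X.ev (c * a.1) + X.ev (c * a.2) * v = 0
    rw [ev_mul c.2 h1, ev_mul c.2 h2]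
    linear_combination X.ev (c : F) * h3

variable {X}

theorem smul_mem_relations {v : Fin n → K} {e : F × F} (he : e ∈ X.relations v) {c : F}
    (hc : c ∈ X.ring) : c • e ∈ X.relations v :=
  (X.relations v).smul_mem ⟨c, hc⟩ he

end PointedCurve

/-! ### Leading terms of `K[x_1]`-combinations -/

namespace StandardForm

open PointedCurve

variable {K F : Type*} [Field K] [Field F] [Algebra K F] {n : ℕ} {X : PointedCurve K F n} {t : ℕ}
  (S : StandardForm X t)

/-- `LeadsAtZ` for an integral weight `s` of `z`. -/
def LeadZ (s : ℤ) (i : ℕ) (e : F × F) : Prop :=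
  e.2 ≠ 0 ∧ X.poleOrd e.2 % (S.a1 : ℤ) = i ∧ X.PoleLE e.1 (X.poleOrd e.2 + s)

/-- `LeadsAtOne` for an integral weight `s` of `z`. -/
def LeadOne (s : ℤ) (i : ℕ) (e : F × F) : Prop :=
  e.1 ≠ 0 ∧ X.poleOrd e.1 % (S.a1 : ℤ) = i ∧ X.PoleLE e.2 (X.poleOrd e.1 - s - 1)

/-- The leading monomials of `f_i` and `g_i` are multiples of `y_i z` and `y_i`. -/
def Leads (s : ℤ) (f g : ℕ → F × F) : Prop :=
  ∀ i < S.a1, S.LeadZ s i (f i) ∧ S.LeadOne s i (g i)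

/-- Integral weights are needed because rebasing at `s` passes to the weight `s - 1`, which is `-1`
for `s = 0`. -/
theorem leads_iff {s : ℕ} {f g : ℕ → F × F} : S.Leads s f g ↔
    ∀ i < S.a1, S.LeadsAtZ s i (f i) ∧ S.LeadsAtOne s i (g i) := by
  have : ∀ a b : ℤ, a ≤ b - s - 1 ↔ a + s < b := fun a b => by omega
  simp only [Leads, LeadZ, LeadOne, LeadsAtZ, LeadsAtOne, PoleLE, this]

section Leading

variable {S} {s : ℤ} {i : ℕ} {e : F × F}

theorem LeadZ.pairDeg (h : S.LeadZ s i e) :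
    X.pairDeg s e = ((2 * X.poleOrd e.2 + (2 * s + 1) : ℤ) : WithBot ℤ) := by
  rw [PointedCurve.pairDeg, affDeg_of_ne h.1, max_eq_right]
  refine ((affDeg_le_iff two_pos).2 h.2.2).trans (WithBot.coe_le_coe.2 ?_)
  omega

theorem LeadOne.pairDeg (h : S.LeadOne s i e) :
    X.pairDeg s e = ((2 * X.poleOrd e.1 + 0 : ℤ) : WithBot ℤ) := by
  rw [PointedCurve.pairDeg, affDeg_of_ne h.1, max_eq_left]
  refine ((affDeg_le_iff two_pos).2 h.2.2).trans (WithBot.coe_le_coe.2 ?_)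
  omega

theorem LeadZ.smul (h : S.LeadZ s i e) {p : K[X]} (hp : p ≠ 0) :
    S.LeadZ s i (aeval S.x1 p • e) := by
  obtain ⟨h1, h2, h3⟩ := h
  have hp' := (S.poleOrd_aeval hp).1
  refine ⟨mul_ne_zero hp' h1, ?_, ?_⟩
  · simp only [Prod.smul_snd, smul_eq_mul]
    rw [X.poleOrd_mul hp' h1, S.poleOrd_aeval_mod, h2]
  · simp only [Prod.smul_snd, Prod.smul_fst, smul_eq_mul]
    rw [X.poleOrd_mul hp' h1]
    exact ((poleLE_self _).mul h3).mono (by linarith)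

theorem LeadOne.smul (h : S.LeadOne s i e) {p : K[X]} (hp : p ≠ 0) :
    S.LeadOne s i (aeval S.x1 p • e) := by
  obtain ⟨h1, h2, h3⟩ := h
  have hp' := (S.poleOrd_aeval hp).1
  refine ⟨mul_ne_zero hp' h1, ?_, ?_⟩
  · simp only [Prod.smul_fst, smul_eq_mul]
    rw [X.poleOrd_mul hp' h1, S.poleOrd_aeval_mod, h2]
  · simp only [Prod.smul_snd, Prod.smul_fst, smul_eq_mul]
    rw [X.poleOrd_mul hp' h1]
    exact ((poleLE_self _).mul h3).mono (by linarith)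

end Leading

/-- The `K[x_1]`-linear combination of `f` and `g` with coefficients `p` and `q`. -/
def comb (f g : ℕ → F × F) (p q : ℕ → K[X]) : F × F :=
  ∑ i ∈ Finset.range S.a1, (aeval S.x1 (p i) • f i + aeval S.x1 (q i) • g i)

theorem comb_eq_disjSum (f g : ℕ → F × F) (p q : ℕ → K[X]) : S.comb f g p q =
    ∑ i ∈ (Finset.range S.a1).disjSum (Finset.range S.a1),
      Sum.elim (fun i => aeval S.x1 (p i) • f i) (fun i => aeval S.x1 (q i) • g i) i := by
  rw [Finset.sum_disjSum, comb, Finset.sum_add_distrib]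
  rfl

section Combination

variable {S} {s : ℤ} {f g : ℕ → F × F}

/-- The degrees of the nonzero terms are pairwise distinct: parity separates `f`-terms from
`g`-terms, and the class modulo `a_1` separates the indices within each family. -/
theorem Leads.pairDeg_comb (h : S.Leads s f g) (p q : ℕ → K[X]) :
    (∀ i < S.a1, X.pairDeg s (aeval S.x1 (p i) • f i) ≤ X.pairDeg s (S.comb f g p q) ∧
      X.pairDeg s (aeval S.x1 (q i) • g i) ≤ X.pairDeg s (S.comb f g p q)) ∧
    (X.pairDeg s (S.comb f g p q) = ⊥ ∨
      (∃ i < S.a1, p i ≠ 0 ∧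
        X.pairDeg s (S.comb f g p q) = X.pairDeg s (aeval S.x1 (p i) • f i)) ∨
      (∃ i < S.a1, q i ≠ 0 ∧
        X.pairDeg s (S.comb f g p q) = X.pairDeg s (aeval S.x1 (q i) • g i))) := by
  have hbotp : ∀ {e : F × F} {p : K[X]}, X.pairDeg s (aeval S.x1 p • e) ≠ ⊥ → p ≠ 0 := by
    rintro e p h rfl
    exact h (pairDeg_eq_bot.2 (by simp))
  have key := (isDegreeLike_pairDeg (X := X) s).sum
    ((Finset.range S.a1).disjSum (Finset.range S.a1))
    (Sum.elim (fun i => aeval S.x1 (p i) • f i) (fun i => aeval S.x1 (q i) • g i)) (by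
      rintro (i | i) hi (j | j) hj hij hb heq
      · simp only [Finset.inl_mem_disjSum, Finset.mem_range, Sum.elim_inl] at hi hj hb heq
        have h1 := (h i hi).1.smul (hbotp hb)
        have h2 := (h j hj).1.smul (hbotp (heq ▸ hb))
        rw [h1.pairDeg, h2.pairDeg, WithBot.coe_inj] at heq
        have h3 := h1.2.1
        rw [show X.poleOrd (aeval S.x1 (p i) • f i).2 = X.poleOrd (aeval S.x1 (p j) • f j).2 by
          omega, h2.2.1] at h3
        exact hij (by rw [Nat.cast_inj.1 h3])
      · simp only [Finset.inl_mem_disjSum, Finset.inr_mem_disjSum, Finset.mem_range,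
          Sum.elim_inl, Sum.elim_inr] at hi hj hb heq
        have hb' := hb
        rw [heq] at hb'
        rw [((h i hi).1.smul (hbotp hb)).pairDeg, ((h j hj).2.smul (hbotp hb')).pairDeg,
          WithBot.coe_inj] at heq
        omega
      · simp only [Finset.inl_mem_disjSum, Finset.inr_mem_disjSum, Finset.mem_range,
          Sum.elim_inl, Sum.elim_inr] at hi hj hb heq
        have hb' := hb
        rw [heq] at hb'
        rw [((h i hi).2.smul (hbotp hb)).pairDeg, ((h j hj).1.smul (hbotp hb')).pairDeg,
          WithBot.coe_inj] at heq
        omega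
      · simp only [Finset.inr_mem_disjSum, Finset.mem_range, Sum.elim_inr] at hi hj hb heq
        have h1 := (h i hi).2.smul (hbotp hb)
        have h2 := (h j hj).2.smul (hbotp (heq ▸ hb))
        rw [h1.pairDeg, h2.pairDeg, WithBot.coe_inj] at heq
        have h3 := h1.2.1
        rw [show X.poleOrd (aeval S.x1 (q i) • g i).1 = X.poleOrd (aeval S.x1 (q j) • g j).1 by
          omega, h2.2.1] at h3
        exact hij (by rw [Nat.cast_inj.1 h3]))
  rw [← S.comb_eq_disjSum] at key
  refine ⟨fun i hi => ⟨key.1 (Sum.inl i) (by simpa), key.1 (Sum.inr i) (by simpa)⟩, ?_⟩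
  by_cases hb : X.pairDeg s (S.comb f g p q) = ⊥
  · exact Or.inl hb
  rcases key.2 with h1 | ⟨i | i, hi, h1⟩
  · exact Or.inl h1
  · exact Or.inr (Or.inl ⟨i, by simpa using hi, hbotp (e := f i) (h1 ▸ hb), h1⟩)
  · exact Or.inr (Or.inr ⟨i, by simpa using hi, hbotp (e := g i) (h1 ▸ hb), h1⟩)

/-- A leading monomial `x_1^k y_i z` of a combination is divisible by that of `f_i`. -/
theorem Leads.poleOrd_le_of_leadZ (h : S.Leads s f g) {p q : ℕ → K[X]} {k : ℕ}
    (he : S.LeadZ s k (S.comb f g p q)) :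
    X.poleOrd (f k).2 ≤ X.poleOrd (S.comb f g p q).2 := by
  rcases (h.pairDeg_comb p q).2 with h1 | ⟨i, hi, hp, h1⟩ | ⟨i, hi, hq, h1⟩
  · rw [he.pairDeg] at h1
    exact absurd h1 WithBot.coe_ne_bot
  · have h2 := (h i hi).1.smul hp
    rw [he.pairDeg, h2.pairDeg, WithBot.coe_inj] at h1
    have h3 : X.poleOrd (S.comb f g p q).2 = X.poleOrd (aeval S.x1 (p i) • f i).2 := by omega
    have h4 := he.2.1
    rw [h3, h2.2.1, Nat.cast_inj] at h4
    subst h4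
    rw [h3, Prod.smul_snd, smul_eq_mul,
      X.poleOrd_mul (S.poleOrd_aeval hp).1 (h i hi).1.1]
    linarith [X.poleOrd_nonneg (S.aeval_mem (p i))]
  · rw [he.pairDeg, ((h i hi).2.smul hq).pairDeg, WithBot.coe_inj] at h1
    omega

/-- A leading monomial `x_1^k y_i` of a combination is divisible by that of `g_i`. -/
theorem Leads.poleOrd_le_of_leadOne (h : S.Leads s f g) {p q : ℕ → K[X]} {k : ℕ}
    (he : S.LeadOne s k (S.comb f g p q)) :
    X.poleOrd (g k).1 ≤ X.poleOrd (S.comb f g p q).1 := by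
  rcases (h.pairDeg_comb p q).2 with h1 | ⟨i, hi, hp, h1⟩ | ⟨i, hi, hq, h1⟩
  · rw [he.pairDeg] at h1
    exact absurd h1 WithBot.coe_ne_bot
  · rw [he.pairDeg, ((h i hi).1.smul hp).pairDeg, WithBot.coe_inj] at h1
    omega
  · have h2 := (h i hi).2.smul hq
    rw [he.pairDeg, h2.pairDeg, WithBot.coe_inj] at h1
    have h3 : X.poleOrd (S.comb f g p q).1 = X.poleOrd (aeval S.x1 (q i) • g i).1 := by omega
    have h4 := he.2.1
    rw [h3, h2.2.1, Nat.cast_inj] at h4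
    subst h4
    rw [h3, Prod.smul_fst, smul_eq_mul,
      X.poleOrd_mul (S.poleOrd_aeval hq).1 (h i hi).2.1]
    linarith [X.poleOrd_nonneg (S.aeval_mem (q i))]

end Combination

/-- `f_0, …, f_{a_1-1}, g_0, …, g_{a_1-1}` are linearly independent over `K[x_1]`. -/
def Indep (f g : ℕ → F × F) : Prop :=
  ∀ p q : ℕ → K[X], S.comb f g p q = 0 → ∀ i < S.a1, p i = 0 ∧ q i = 0

/-- `f_0, …, f_{a_1-1}, g_0, …, g_{a_1-1}` generate the module of relations over `K[x_1]`. -/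
def Generates (f g : ℕ → F × F) (v : Fin n → K) : Prop :=
  (∀ i < S.a1, f i ∈ X.relations v ∧ g i ∈ X.relations v) ∧
    ∀ e ∈ X.relations v, ∃ p q : ℕ → K[X], e = S.comb f g p q

theorem Leads.indep {S : StandardForm X t} {s : ℤ} {f g : ℕ → F × F} (h : S.Leads s f g) :
    S.Indep f g := by
  intro p q h0 i hi
  have h1 := (h.pairDeg_comb p q).1 i hi
  rw [h0, (isDegreeLike_pairDeg s).zero, le_bot_iff, le_bot_iff, pairDeg_eq_bot,
    pairDeg_eq_bot, smul_eq_zero, smul_eq_zero, S.aeval_eq_zero_iff, S.aeval_eq_zero_iff] at h1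
  refine ⟨h1.1.resolve_right fun h2 => (h i hi).1.1 (by rw [h2]; rfl),
    h1.2.resolve_right fun h2 => (h i hi).2.1 (by rw [h2]; rfl)⟩

/-! ### The substitution `z ↦ z + w φ_s` -/

section Shift

theorem subst_subst_neg (w : K) (s : ℕ) (e : F × F) : S.subst w s (S.subst (-w) s e) = e := by
  ext <;> simp [subst]

theorem subst_comb (w : K) (s : ℕ) (f g : ℕ → F × F) (p q : ℕ → K[X]) :
    S.subst w s (S.comb f g p q) =
      S.comb (fun i => S.subst w s (f i)) (fun i => S.subst w s (g i)) p q := by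
  ext
  · simp only [subst, comb, Prod.fst_sum, Prod.snd_sum, Prod.fst_add, Prod.snd_add, Prod.smul_fst,
      Prod.smul_snd, smul_eq_mul, Finset.mul_sum, ← Finset.sum_add_distrib]
    exact Finset.sum_congr rfl fun i _ => by ring
  · simp [subst, comb, Prod.snd_sum]

theorem subst_zero (w : K) (s : ℕ) : S.subst w s 0 = 0 := by ext <;> simp [subst]

theorem subst_mem_relations {w : K} {s : ℕ} {e : F × F} {v : Fin n → K}
    (he : e ∈ X.relations v) :
    S.subst w s e ∈ X.relations (v - X.ev (algebraMap K F w * S.φ s)) := by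
  obtain ⟨h1, h2, h3⟩ := he
  have h4 : algebraMap K F w * S.φ s ∈ X.ring :=
    X.ring.mul_mem (X.ring.algebraMap_mem w) (S.φ_mem s)
  refine ⟨X.ring.add_mem h1 (X.ring.mul_mem h4 h2), h2, ?_⟩
  simp only [subst]
  rw [ev_add h1 (X.ring.mul_mem h4 h2), ev_mul h4 h2]
  linear_combination h3

theorem subst_neg_mem_relations {w : K} {s : ℕ} {e : F × F} {v : Fin n → K}
    (he : e ∈ X.relations (v - X.ev (algebraMap K F w * S.φ s))) :
    S.subst (-w) s e ∈ X.relations v := by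
  have := S.subst_mem_relations (w := -w) (s := s) he
  have h4 : algebraMap K F w * S.φ s ∈ X.ring :=
    X.ring.mul_mem (X.ring.algebraMap_mem w) (S.φ_mem s)
  rwa [map_neg, neg_mul, ev_neg h4, sub_neg_eq_add, sub_add_cancel] at this

end Shift

section Index

theorem idx_lt (s i : ℕ) : S.idx s i < S.a1 := Nat.mod_lt _ S.a1_pos

theorem idx_injOn (s : ℕ) : Set.InjOn (S.idx s) (Finset.range S.a1) := by
  intro i hi j hj h
  have h1 : i ≡ j [MOD S.a1] := Nat.ModEq.add_right_cancel' s h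
  rw [Finset.coe_range, Set.mem_Iio] at hi hj
  exact Nat.ModEq.eq_of_lt_of_lt h1 hi hj

theorem idx_surj (s : ℕ) {j : ℕ} (hj : j < S.a1) : ∃ i < S.a1, S.idx s i = j := by
  have h := Finset.surjOn_of_injOn_of_card_le (s := Finset.range S.a1) (t := Finset.range S.a1)
    (S.idx s) (fun i _ => by simpa using S.idx_lt s i) (S.idx_injOn s) le_rfl
  obtain ⟨i, hi, h⟩ := h (by simpa using hj : j ∈ ((Finset.range S.a1 : Finset ℕ) : Set ℕ))
  exact ⟨i, by simpa using hi, h⟩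

theorem sum_idx {M : Type*} [AddCommMonoid M] (s : ℕ) (u : ℕ → M) :
    ∑ i ∈ Finset.range S.a1, u (S.idx s i) = ∑ i ∈ Finset.range S.a1, u i :=
  Finset.sum_nbij (S.idx s) (fun i _ => by simpa using S.idx_lt s i) (S.idx_injOn s)
    (fun j hj => by
      obtain ⟨i, hi, h⟩ := S.idx_surj s (j := j) (by simpa using hj)
      exact ⟨i, by simpa using hi, h⟩) fun _ _ => rfl

theorem exists_comp_idx {α : Type*} (s : ℕ) (u : ℕ → α) :
    ∃ q : ℕ → α, ∀ i < S.a1, q (S.idx s i) = u i :=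
  ⟨u ∘ Function.invFunOn (S.idx s) (Finset.range S.a1 : Finset ℕ), fun i hi => by
    have h := (S.idx_injOn s).leftInvOn_invFunOn (by simpa using hi :
      i ∈ ((Finset.range S.a1 : Finset ℕ) : Set ℕ))
    simp only [Function.comp_apply, h]⟩

theorem comb_idx (s : ℕ) (f g : ℕ → F × F) (p q : ℕ → K[X]) : S.comb f g p q =
    ∑ i ∈ Finset.range S.a1,
      (aeval S.x1 (p i) • f i + aeval S.x1 (q (S.idx s i)) • g (S.idx s i)) := by
  rw [comb, Finset.sum_add_distrib, Finset.sum_add_distrib,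
    S.sum_idx s (fun i => aeval S.x1 (q i) • g i)]

end Index

/-! ### Transition matrices of rebasing -/

/-- Polynomial transition matrices of nonzero determinant, from the pairs `(f'_i, g'_{i'})` to the
substituted pairs `(f_i, g_{i'})`. -/
def HasTransition (s : ℕ) (w : K) (f g f' g' : ℕ → F × F) : Prop :=
  ∃ m₁₁ m₁₂ m₂₁ m₂₂ : ℕ → K[X], ∀ i < S.a1, m₁₁ i * m₂₂ i - m₁₂ i * m₂₁ i ≠ 0 ∧
    S.subst w s (f i) = aeval S.x1 (m₁₁ i) • f' i + aeval S.x1 (m₁₂ i) • g' (S.idx s i) ∧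
    S.subst w s (g (S.idx s i)) =
      aeval S.x1 (m₂₁ i) • f' i + aeval S.x1 (m₂₂ i) • g' (S.idx s i)

section Transition

variable {S} {s : ℕ} {w : K} {f g f' g' : ℕ → F × F}

theorem HasTransition.subst_comb {m₁₁ m₁₂ m₂₁ m₂₂ : ℕ → K[X]}
    (hm : ∀ i < S.a1, S.subst w s (f i) =
        aeval S.x1 (m₁₁ i) • f' i + aeval S.x1 (m₁₂ i) • g' (S.idx s i) ∧
      S.subst w s (g (S.idx s i)) =
        aeval S.x1 (m₂₁ i) • f' i + aeval S.x1 (m₂₂ i) • g' (S.idx s i)) (p q : ℕ → K[X]) :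
    ∃ q' : ℕ → K[X],
      (∀ i < S.a1, q' (S.idx s i) = p i * m₁₂ i + q (S.idx s i) * m₂₂ i) ∧
      S.subst w s (S.comb f g p q) =
        S.comb f' g' (fun i => p i * m₁₁ i + q (S.idx s i) * m₂₁ i) q' := by
  obtain ⟨q', hq'⟩ := S.exists_comp_idx s fun i => p i * m₁₂ i + q (S.idx s i) * m₂₂ i
  refine ⟨q', hq', ?_⟩
  rw [S.subst_comb, S.comb_idx s, S.comb_idx s]
  refine Finset.sum_congr rfl fun i hi => ?_
  rw [Finset.mem_range] at hi
  rw [hq' i hi, (hm i hi).1, (hm i hi).2]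
  simp only [map_add, map_mul, smul_add, add_smul, mul_smul]
  abel

/-- A dependence of the old family becomes one of the new family after substitution; the adjugate
matrices then show that the original coefficients vanish up to nonzero determinants. -/
theorem HasTransition.indep (h : S.HasTransition s w f g f' g') (hi : S.Indep f' g') :
    S.Indep f g := by
  obtain ⟨m₁₁, m₁₂, m₂₁, m₂₂, hm⟩ := h
  intro p q h0
  obtain ⟨q', hq', h1⟩ := HasTransition.subst_comb (fun i hi => (hm i hi).2) p q
  rw [h0, S.subst_zero] at h1
  have h2 := hi _ _ h1.symm
  have h3 : ∀ i < S.a1, p i = 0 ∧ q (S.idx s i) = 0 := by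
    intro i hi
    have h4 := (h2 i hi).1
    have h5 := (h2 _ (S.idx_lt s i)).2
    rw [hq' i hi] at h5
    have hd := (hm i hi).1
    constructor
    · refine (mul_eq_zero.1 (?_ : p i * (m₁₁ i * m₂₂ i - m₁₂ i * m₂₁ i) = 0)).resolve_right hd
      linear_combination m₂₂ i * h4 - m₂₁ i * h5
    · refine (mul_eq_zero.1
        (?_ : q (S.idx s i) * (m₁₁ i * m₂₂ i - m₁₂ i * m₂₁ i) = 0)).resolve_right hd
      linear_combination m₁₁ i * h5 - m₁₂ i * h4
  intro i hi
  refine ⟨(h3 i hi).1, ?_⟩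
  obtain ⟨j, hj, rfl⟩ := S.idx_surj s hi
  exact (h3 j hj).2

/-- It suffices that the old family factors through the new one; the determinants play no role here.
-/
theorem HasTransition.generates (h : S.HasTransition s w f g f' g') {v : Fin n → K}
    (hg : S.Generates f g v)
    (hmem : ∀ i < S.a1, f' i ∈ X.relations (v - X.ev (algebraMap K F w * S.φ s)) ∧
      g' i ∈ X.relations (v - X.ev (algebraMap K F w * S.φ s))) :
    S.Generates f' g' (v - X.ev (algebraMap K F w * S.φ s)) := by
  obtain ⟨m₁₁, m₁₂, m₂₁, m₂₂, hm⟩ := h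
  refine ⟨hmem, fun e he => ?_⟩
  obtain ⟨p, q, hpq⟩ := hg.2 _ (S.subst_neg_mem_relations he)
  obtain ⟨q', -, h1⟩ := HasTransition.subst_comb (fun i hi => (hm i hi).2) p q
  rw [← hpq, S.subst_subst_neg] at h1
  exact ⟨_, _, h1⟩

/-- Nothing is assumed about leading terms, so `ρ` may degenerate to `0`. This matters only for `c_i
> 0`, where the determinant is `ρ⁻¹`; independence of the new family excludes it. In the other cases
the matrix is unitriangular. -/
theorem IsRebasing.hasTransition (h : S.IsRebasing s w f g f' g') (hi : S.Indep f' g') :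
    S.HasTransition s w f g f' g' := by
  have key : ∀ i < S.a1, ∃ m₁₁ m₁₂ m₂₁ m₂₂ : K[X], m₁₁ * m₂₂ - m₁₂ * m₂₁ ≠ 0 ∧
    S.subst w s (f i) = aeval S.x1 m₁₁ • f' i + aeval S.x1 m₁₂ • g' (S.idx s i) ∧
    S.subst w s (g (S.idx s i)) =
      aeval S.x1 m₂₁ • f' i + aeval S.x1 m₂₂ • g' (S.idx s i) := by
    intro i hia
    obtain ⟨h1, h2, h3⟩ := h i hia
    by_cases hv : S.vote s f i = w
    · obtain ⟨hg, hf⟩ := h1 hv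
      exact ⟨1, 0, 0, 1, by simp, by simp [hf], by simp [hg]⟩
    rcases lt_or_ge 0 (S.cPair s f g i) with hc | hc
    · obtain ⟨hg, hf⟩ := h2 hv hc
      set ρ : K := S.mu s f i * (w - S.vote s f i) / (S.dDiag g (S.idx s i)).leadingCoeff
      by_cases hρ : ρ = 0
      · exfalso
        -- With `ρ = 0` one has `f'_i = x_1^c g'_{i'}`, a nontrivial dependence.
        have h4 := hi (Pi.single i 1)
          (Pi.single (S.idx s i) (-Polynomial.X ^ (S.cPair s f g i).toNat)) (by
            rw [S.comb_idx s, Finset.sum_eq_single i]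
            · simp [hf, hg, hρ]
            · intro j hj hji
              have hne : S.idx s j ≠ S.idx s i := fun h =>
                hji (S.idx_injOn s hj (by simpa using hia) h)
              simp [hji, hne]
            · intro hn; exact absurd (Finset.mem_range.2 hia) hn) i hia
        simp at h4
      · refine ⟨0, 1, -C ρ⁻¹, C ρ⁻¹ * Polynomial.X ^ (S.cPair s f g i).toNat, by simpa using hρ,
          by simp [hg], ?_⟩
        have hρ' : algebraMap K F ρ ≠ 0 := by simpa using hρ
        rw [hf, hg]
        simp only [map_neg, map_mul, aeval_C, map_pow, aeval_X, map_inv₀]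
        ext
        · simp only [Prod.fst_add, Prod.smul_fst, Prod.fst_sub, smul_eq_mul]
          field_simp
          ring
        · simp only [Prod.snd_add, Prod.smul_snd, Prod.snd_sub, smul_eq_mul]
          field_simp
          ring
    · obtain ⟨hg, hf⟩ := h3 hv hc
      refine ⟨1, C (S.mu s f i * (w - S.vote s f i) / (S.dDiag g (S.idx s i)).leadingCoeff) *
        Polynomial.X ^ (-S.cPair s f g i).toNat, 0, 1, by simp, ?_, by simp [hg]⟩
      rw [hf, hg]
      simp
  choose! m₁₁ m₁₂ m₂₁ m₂₂ hm using key
  exact ⟨m₁₁, m₁₂, m₂₁, m₂₂, hm⟩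

theorem IsRebasing.mem_relations (h : S.IsRebasing s w f g f' g') {v : Fin n → K}
    (hmem : ∀ i < S.a1, f i ∈ X.relations v ∧ g i ∈ X.relations v) :
    ∀ i < S.a1, f' i ∈ X.relations (v - X.ev (algebraMap K F w * S.φ s)) ∧
      g' i ∈ X.relations (v - X.ev (algebraMap K F w * S.φ s)) := by
  set v' := v - X.ev (algebraMap K F w * S.φ s) with hv'
  have key : ∀ i < S.a1, f' i ∈ X.relations v' ∧ g' (S.idx s i) ∈ X.relations v' := by
    intro i hi
    obtain ⟨h1, h2, h3⟩ := h i hi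
    have hF : S.subst w s (f i) ∈ X.relations v' := S.subst_mem_relations (hmem i hi).1
    have hG : S.subst w s (g (S.idx s i)) ∈ X.relations v' :=
      S.subst_mem_relations (hmem _ (S.idx_lt s i)).2
    by_cases hv : S.vote s f i = w
    · obtain ⟨hg, hf⟩ := h1 hv
      rw [hf, hg]
      exact ⟨hF, hG⟩
    rcases lt_or_ge 0 (S.cPair s f g i) with hc | hc
    · obtain ⟨hg, hf⟩ := h2 hv hc
      rw [hf, hg]
      exact ⟨Submodule.sub_mem _ (smul_mem_relations hF (X.ring.pow_mem S.x1_mem _))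
        (smul_mem_relations hG (X.ring.algebraMap_mem _)), hF⟩
    · obtain ⟨hg, hf⟩ := h3 hv hc
      rw [hf, hg]
      exact ⟨Submodule.sub_mem _ hF (smul_mem_relations hG
        (X.ring.mul_mem (X.ring.algebraMap_mem _) (X.ring.pow_mem S.x1_mem _))), hG⟩
  intro i hi
  refine ⟨(key i hi).1, ?_⟩
  obtain ⟨j, hj, rfl⟩ := S.idx_surj s hi
  exact (key j hj).2

/-- No admissibility of `w` enters, so a hypothetical step with `ω` is always available. Since `g'`
is prescribed at `i'`, the permutation `i ↦ i'` has to be inverted. -/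
theorem exists_isRebasing (S : StandardForm X t) (s : ℕ) (w : K) (f g : ℕ → F × F) :
    ∃ f' g', S.IsRebasing s w f g f' g' := by
  classical
  let F₁ := fun i => S.subst w s (f i)
  let G₁ := fun i => S.subst w s (g (S.idx s i))
  let ρ : ℕ → F := fun i => algebraMap K F
    (S.mu s f i * (w - S.vote s f i) / (S.dDiag g (S.idx s i)).leadingCoeff)
  obtain ⟨g', hg'⟩ := S.exists_comp_idx s fun i =>
    if S.vote s f i = w then G₁ i else if 0 < S.cPair s f g i then F₁ i else G₁ i
  refine ⟨fun i => if S.vote s f i = w then F₁ i else if 0 < S.cPair s f g i then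
    S.x1 ^ (S.cPair s f g i).toNat • F₁ i - ρ i • G₁ i
    else F₁ i - (ρ i * S.x1 ^ (-S.cPair s f g i).toNat) • G₁ i, g', fun i hi => ?_⟩
  refine ⟨fun h1 => ?_, fun h1 h2 => ?_, fun h1 h2 => ?_⟩
  · rw [hg' i hi]; simp [h1, F₁, G₁]
  · rw [hg' i hi]; simp [h1, h2, F₁, G₁, ρ]
  · rw [hg' i hi]; simp [h1, not_lt.2 h2, F₁, G₁, ρ]

end Transition

end StandardForm

/-! ### One rebasing step on leading terms -/

namespace StandardForm

open PointedCurve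

variable {K F : Type*} [Field K] [Field F] [Algebra K F] {n : ℕ} {X : PointedCurve K F n} {t : ℕ}
  {S : StandardForm X t}

/-- The leading data of the pair `(f_i, g_{i'})` and of its substituted form. -/
structure PairData (S : StandardForm X t) (s : ℕ) (f g : ℕ → F × F) (i d e : ℕ) : Prop where
  d_mem : d ∈ X.H
  e_mem : e ∈ X.H
  d_mod : d % S.a1 = S.idx s i
  e_mod : e % S.a1 = S.idx s i
  poleOrd_f : X.poleOrd (f i).2 + s = d
  poleOrd_g : X.poleOrd (g (S.idx s i)).1 = e
  a1_mul_cPair : S.a1 * S.cPair s f g i = e - d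
  mu_ne_zero : S.mu s f i ≠ 0
  lead_ne_zero : (S.dDiag g (S.idx s i)).leadingCoeff ≠ 0
  topCoeff_f : ∀ w, S.TopCoeff d (S.mu s f i * (w - S.vote s f i)) (S.subst w s (f i)).1
  topCoeff_g : ∀ w, S.TopCoeff e (S.dDiag g (S.idx s i)).leadingCoeff
    (S.subst w s (g (S.idx s i))).1

variable {s : ℕ} {f g f' g' : ℕ → F × F}

/-- This is where the vote gets its meaning: at `φ_d` the `z`-free part of `f_i` contributes `-μ_i
w_{s,i}` and the substituted `z`-part contributes `w μ_i`. The top of `g_{i'}` is untouched, since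
its `z`-part is strictly smaller for the weight `s`. -/
theorem Leads.exists_pairData (h : S.Leads s f g) (hs : s ∈ X.H)
    (hmem : ∀ i < S.a1, ((f i).1 ∈ X.ring ∧ (f i).2 ∈ X.ring) ∧ (g i).1 ∈ X.ring)
    {i : ℕ} (hi : i < S.a1) : ∃ d e : ℕ, PairData S s f g i d e := by
  have hi' := S.idx_lt s i
  obtain ⟨⟨hf1, hf2⟩, -⟩ := hmem i hi
  obtain ⟨-, hg1⟩ := hmem _ hi'
  obtain ⟨hZ0, hZmod, hZle⟩ := (h i hi).1
  obtain ⟨hO0, hOmod, hOle⟩ := (h _ hi').2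
  obtain ⟨A, hA⟩ := Int.eq_ofNat_of_zero_le (X.poleOrd_nonneg hf2)
  obtain ⟨e, he⟩ := Int.eq_ofNat_of_zero_le (X.poleOrd_nonneg hg1)
  have hAH := X.mem_H_of_poleOrd hf2 hZ0 hA
  have heH := X.mem_H_of_poleOrd hg1 hO0 he
  have hd := S.add_mem_H hAH hs
  have hAmod : A % S.a1 = i := by
    rw [hA] at hZmod; exact_mod_cast hZmod
  have hemod : e % S.a1 = S.idx s i := by
    rw [he] at hOmod; exact_mod_cast hOmod
  have hdmod : (A + s) % S.a1 = S.idx s i := by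
    rw [idx, Nat.add_mod, hAmod, Nat.add_mod_mod]
  obtain ⟨ha0, ha1, ha2⟩ := S.coord_lead hf2 hZ0 hi hZmod
  obtain ⟨hd0, hd1, hd2⟩ := S.coord_lead hg1 hO0 hi' hOmod
  obtain ⟨hay0, hay⟩ := S.poleOrd_aeval_mul_y ha0 hi
  rw [← ha1] at hay
  have hb := S.eq_b_add hd
  rw [hdmod] at hb
  set k := (A + s - S.b (S.idx s i)) / S.a1 with hk
  have ha1pos : (0 : ℤ) < S.a1 := by exact_mod_cast S.a1_pos
  -- The integer division in `kPair` is exact, because `d` is a nongap in the class of `i'`.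
  have hkP : S.kPair s f i = k := by
    rw [kPair, aDiag, hay, hA, S.poleOrd_y hi']
    apply Int.ediv_eq_of_eq_mul_right ha1pos.ne'
    have : ((A + s : ℕ) : ℤ) = ((S.b (S.idx s i) + S.a1 * k : ℕ) : ℤ) := by rw [← hb]
    push_cast at this
    linarith
  have hmu := S.topCoeff_lc (X.ring.mul_mem (X.ring.mul_mem (S.aeval_mem (S.aDiag f i))
    (S.y_mem i)) (S.φ_mem s)) (mul_ne_zero hay0 (S.φ_ne_zero s)) (d := A + s) (by
      rw [aDiag, X.poleOrd_mul hay0 (S.φ_ne_zero s), hay, hA, S.poleOrd_φ hs]; rfl)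
  have hφf : S.TopCoeff (A + s) (S.mu s f i) (S.φ s * (f i).2) := by
    refine hmu.1.congr ?_
    have := (poleLE_self (X := X) (S.φ s)).mul ha2
    rw [S.poleOrd_φ hs, hA] at this
    convert this using 1
    · rw [aDiag]; ring
    · push_cast; ring
  have hf1top : S.TopCoeff (A + s) (-(S.mu s f i * S.vote s f i)) (f i).1 := by
    have h1 := topCoeff_coord (S := S) hf1 hd (by rw [hA] at hZle; exact_mod_cast hZle)
    rw [hdmod, ← hk] at h1
    convert h1 using 1
    have hmu0 : S.mu s f i ≠ 0 := hmu.2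
    rw [vote, hkP, Int.toNat_natCast]
    field_simp
  have hg1top : S.TopCoeff e (S.dDiag g (S.idx s i)).leadingCoeff (g (S.idx s i)).1 := by
    rw [he] at hd1 hd2
    refine (topCoeff_aeval_mul_y hi' le_rfl ?_).congr hd2
    zify
    rw [dDiag]
    linarith
  refine ⟨A + s, e, hd, heH, hdmod, hemod, by rw [hA]; rfl, he, ?_, hmu.2,
    leadingCoeff_ne_zero.2 hd0, fun w => ?_, fun w => ?_⟩
  · rw [cPair, hkP, dDiag]
    rw [he] at hd1
    have : ((A + s : ℕ) : ℤ) = ((S.b (S.idx s i) + S.a1 * k : ℕ) : ℤ) := by rw [← hb]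
    rw [this, mul_sub]
    push_cast at hd1 ⊢
    linarith
  · have := hf1top.add (hφf.const_mul w)
    convert this using 1
    · ring
    · simp only [subst]; ring
  · refine hg1top.congr ?_
    simp only [subst, add_sub_cancel_left]
    have := ((poleLE_self (X := X) (S.φ s)).mul hOle).const_mul w
    rw [S.poleOrd_φ hs, he] at this
    refine (mul_assoc (algebraMap K F w) _ _ ▸ this).mono ?_
    linarith

open Classical in
/-- Rebasing turns leading data for the weight `s` into leading data for the weight `s - 1`. -/
theorem IsRebasing.lead {w : K} (h : S.IsRebasing s w f g f' g') (hL : S.Leads s f g)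
    (hs : s ∈ X.H)
    (hmem : ∀ i < S.a1, ((f i).1 ∈ X.ring ∧ (f i).2 ∈ X.ring) ∧ (g i).1 ∈ X.ring)
    {i : ℕ} (hi : i < S.a1) :
    S.LeadZ (s - 1) i (f' i) ∧ S.LeadOne (s - 1) (S.idx s i) (g' (S.idx s i)) ∧
      X.poleOrd (f' i).2 = X.poleOrd (f i).2 +
        S.a1 * (if S.vote s f i = w then 0 else S.cBar s f g i) := by
  have hi' := S.idx_lt s i
  obtain ⟨d, e, D⟩ := hL.exists_pairData hs hmem hi
  obtain ⟨hZ0, hZmod, hZle⟩ := (hL i hi).1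
  obtain ⟨hO0, hOmod, hOle⟩ := (hL _ hi').2
  obtain ⟨h1, h2, h3⟩ := h i hi
  have hF := D.topCoeff_f w
  have hG := D.topCoeff_g w
  have hGp := hG.poleOrd D.e_mem D.lead_ne_zero
  have hAd : X.poleOrd (f i).2 = d - s := by linarith [D.poleOrd_f]
  have hO' : X.PoleLE (g (S.idx s i)).2 (e - s - 1) := by rw [← D.poleOrd_g]; exact hOle
  have hGlead : S.LeadOne (s - 1) (S.idx s i) (S.subst w s (g (S.idx s i))) := by
    refine ⟨hGp.1, ?_, ?_⟩
    · rw [hGp.2]; exact_mod_cast D.e_mod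
    · rw [hGp.2]; exact hO'.mono (by linarith)
  by_cases hv : S.vote s f i = w
  · obtain ⟨hg', hf'⟩ := h1 hv
    rw [hg', hf']
    refine ⟨⟨hZ0, hZmod, ?_⟩, hGlead, by simp [hv, subst]⟩
    rw [hv, sub_self, mul_zero, topCoeff_zero_iff] at hF
    refine hF.mono ?_
    simp only [subst]
    linarith
  have hcoef : S.mu s f i * (w - S.vote s f i) ≠ 0 :=
    mul_ne_zero D.mu_ne_zero (sub_ne_zero.2 (Ne.symm hv))
  have hFp := hF.poleOrd D.d_mem hcoef
  have hρ : S.mu s f i * (w - S.vote s f i) / (S.dDiag g (S.idx s i)).leadingCoeff *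
      (S.dDiag g (S.idx s i)).leadingCoeff = S.mu s f i * (w - S.vote s f i) :=
    div_mul_cancel₀ _ D.lead_ne_zero
  set ρ : K := S.mu s f i * (w - S.vote s f i) / (S.dDiag g (S.idx s i)).leadingCoeff
  have hac := D.a1_mul_cPair
  rcases lt_or_ge 0 (S.cPair s f g i) with hc | hc
  -- Here `x_1^c` lifts `f_i` to the level of `g_{i'}`, where the tops cancel, so the pole order of
  -- the `z`-part rises by `a_1 c`. For the weight `s - 1` the old `F₁` is led by its `z`-free part
  -- and replaces `g_{i'}`.
  · obtain ⟨hg', hf'⟩ := h2 hv hc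
    obtain ⟨c, hcc⟩ := Int.eq_ofNat_of_zero_le hc.le
    rw [hcc] at hac
    have hde : d + S.a1 * c = e := by zify; linarith
    have hxf : S.x1 ^ c * (f i).2 ≠ 0 := mul_ne_zero (pow_ne_zero _ S.x1_ne_zero) hZ0
    have hxfp : X.poleOrd (S.x1 ^ c * (f i).2) = e - s := by
      rw [X.poleOrd_mul (pow_ne_zero _ S.x1_ne_zero) hZ0, X.poleOrd_pow S.x1_ne_zero,
        S.poleOrd_x1, hAd]
      linarith
    have hp2 : (f' i).2 ≠ 0 ∧ X.poleOrd (f' i).2 = e - s := by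
      rw [← hxfp]
      refine poleOrd_eq_of_sub hxf ?_
      rw [hf', hxfp, hcc]
      simp only [Prod.snd_sub, Prod.smul_snd, smul_eq_mul, subst,
        Int.toNat_natCast, sub_sub_cancel_left]
      exact (hO'.const_mul ρ).neg
    have hp1 : X.PoleLE (f' i).1 (e - 1) := by
      rw [← topCoeff_zero_iff (S := S)]
      have h4 := (hF.x1_pow_mul D.d_mem c)
      rw [hde] at h4
      have h5 := h4.sub (hG.const_mul ρ)
      rw [hρ, sub_self] at h5
      rw [hf', hcc]
      simpa only [Prod.fst_sub, Prod.smul_fst, smul_eq_mul,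
        Int.toNat_natCast] using h5
    refine ⟨⟨hp2.1, ?_, ?_⟩, ?_, ?_⟩
    · rw [hp2.2, show (e : ℤ) - s = X.poleOrd (f i).2 + S.a1 * c by linarith,
        Int.add_mul_emod_self_left, hZmod]
    · rw [hp2.2]; exact hp1.mono (by linarith)
    · rw [hg']
      refine ⟨hFp.1, ?_, ?_⟩
      · rw [hFp.2]; exact_mod_cast D.d_mod
      · rw [hFp.2]
        simp only [subst]
        exact (poleLE_self _).mono (by linarith)
    · rw [hp2.2, if_neg hv, cBar, max_eq_left hc.le, D.a1_mul_cPair]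
      linarith
  -- Now `g_{i'}` is the lower one. Its multiple cancels the top of the `z`-free part, and its
  -- `z`-part stays below that of `f_i`, whose pole order is therefore kept.
  · obtain ⟨hg', hf'⟩ := h3 hv hc
    obtain ⟨c, hcc⟩ := Int.eq_ofNat_of_zero_le (neg_nonneg.2 hc)
    have hac' : (S.a1 : ℤ) * c = d - e := by
      have : S.cPair s f g i = -(c : ℤ) := by linarith
      rw [this] at hac
      linarith
    have hde : e + S.a1 * c = d := by zify; linarith
    have hp2 : (f' i).2 ≠ 0 ∧ X.poleOrd (f' i).2 = X.poleOrd (f i).2 := by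
      refine poleOrd_eq_of_sub hZ0 ?_
      rw [hf', hcc]
      simp only [Prod.snd_sub, Prod.smul_snd, smul_eq_mul, subst,
        Int.toNat_natCast, sub_sub_cancel_left]
      have := ((poleLE_self (X := X) (S.x1 ^ c)).mul hO').const_mul ρ
      rw [X.poleOrd_pow S.x1_ne_zero, S.poleOrd_x1, ← mul_assoc] at this
      exact this.neg.mono (by linarith)
    have hp1 : X.PoleLE (f' i).1 (d - 1) := by
      rw [← topCoeff_zero_iff (S := S)]
      have h4 := ((hG.const_mul ρ).x1_pow_mul D.e_mem c)
      rw [hde] at h4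
      have h5 := hF.sub h4
      rw [hρ, sub_self] at h5
      rw [hf', hcc]
      simp only [Prod.fst_sub, Prod.smul_fst, smul_eq_mul,
        Int.toNat_natCast]
      convert h5 using 2
      ring
    refine ⟨⟨hp2.1, by rw [hp2.2, hZmod], ?_⟩, by rw [hg']; exact hGlead, ?_⟩
    · rw [hp2.2]; exact hp1.mono (by linarith)
    · rw [hp2.2, if_neg hv, cBar, max_eq_right hc, mul_zero, add_zero]

theorem IsRebasing.leads {w : K} (h : S.IsRebasing s w f g f' g') (hL : S.Leads s f g)
    (hs : s ∈ X.H)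
    (hmem : ∀ i < S.a1, ((f i).1 ∈ X.ring ∧ (f i).2 ∈ X.ring) ∧ (g i).1 ∈ X.ring) :
    S.Leads (s - 1) f' g' := by
  intro i hi
  refine ⟨(h.lead hL hs hmem hi).1, ?_⟩
  obtain ⟨j, hj, rfl⟩ := S.idx_surj s hi
  exact (h.lead hL hs hmem hj).2.1

theorem Generates.mem_ring {v : Fin n → K} (h : S.Generates f g v) :
    ∀ i < S.a1, ((f i).1 ∈ X.ring ∧ (f i).2 ∈ X.ring) ∧ (g i).1 ∈ X.ring := fun i hi =>
  ⟨⟨(h.1 i hi).1.1, (h.1 i hi).1.2.1⟩, (h.1 i hi).2.1⟩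

/-! ### Invariants along a run of the algorithm -/

variable {Γ : Set ℕ} {τ N : ℕ} {r rs : Fin n → K}

theorem span_φ_le {f : F} {A : Set ℕ} (hf : f ∈ Submodule.span K (S.φ '' A)) : f ∈ X.ring := by
  have h : Submodule.span K (S.φ '' A) ≤ Subalgebra.toSubmodule X.ring := by
    rw [Submodule.span_le]
    rintro _ ⟨u, -, rfl⟩
    exact S.φ_mem u
  exact h hf

/-- The functions `η_i` generate `𝓛(-D + ∞Q)` over `K[x_1]`. -/
theorem exists_expand_η (S : StandardForm X t) {f : F} (hf : f ∈ X.LMinusD) :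
    ∃ q : ℕ → K[X], f = ∑ j ∈ Finset.range S.a1, aeval S.x1 (q j) * S.η j := by
  have key : ∀ (m : ℕ) (f : F), f ∈ X.LMinusD → X.PoleLE f (m - 1) →
      ∃ q : ℕ → K[X], f = ∑ j ∈ Finset.range S.a1, aeval S.x1 (q j) * S.η j := by
    intro m
    induction m with
    | zero =>
      intro f hf h
      exact ⟨0, by rw [X.eq_zero_of_poleLE_neg hf.1 (by norm_num) h]; simp⟩
    | succ m ih =>
      intro f hf h
      by_cases h0 : f = 0
      · exact ⟨0, by simp [h0]⟩
      have hfR : f ∈ X.ring := hf.1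
      obtain ⟨d, hd⟩ := Int.eq_ofNat_of_zero_le (X.poleOrd_nonneg hfR)
      have hj := Nat.mod_lt d S.a1_pos
      set j := d % S.a1
      have hmod : X.poleOrd f % (S.a1 : ℤ) = j := by rw [hd]; rfl
      have hηR : S.η j ∈ X.ring := (S.η_mem j hj).1
      obtain ⟨e, he⟩ := Int.eq_ofNat_of_zero_le (X.poleOrd_nonneg hηR)
      have hle : X.poleOrd (S.η j) ≤ X.poleOrd f := S.η_least j hj f hf h0 hmod
      have hmod' : X.poleOrd (S.η j) % (S.a1 : ℤ) = j := S.η_class j hj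
      obtain ⟨k, hk⟩ : ∃ k : ℕ, d = e + S.a1 * k := by
        rw [hd, he] at hle
        have hle' : e ≤ d := by exact_mod_cast hle
        have h2 : e ≡ d [MOD S.a1] := by
          rw [← hmod, hd, he] at hmod'
          exact_mod_cast hmod'
        obtain ⟨k, hk⟩ := (Nat.modEq_iff_dvd' hle').1 h2
        exact ⟨k, by omega⟩
      have hη0 := S.η_ne j hj
      have hne : S.x1 ^ k * S.η j ≠ 0 := mul_ne_zero (pow_ne_zero _ S.x1_ne_zero) hη0
      have hp : X.poleOrd (S.x1 ^ k * S.η j) = X.poleOrd f := by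
        rw [X.poleOrd_mul (pow_ne_zero _ S.x1_ne_zero) hη0, X.poleOrd_pow S.x1_ne_zero,
          S.poleOrd_x1, he, hd, hk]
        push_cast
        ring
      obtain ⟨c, hc⟩ := X.exists_sub_poleLE (f := f) hne (by rw [hp]; exact poleLE_self f)
      have hxR : S.x1 ^ k * S.η j ∈ X.ring := X.ring.mul_mem (X.ring.pow_mem S.x1_mem _) hηR
      have hcR := X.ring.mul_mem (X.ring.algebraMap_mem c) hxR
      obtain ⟨q, hq⟩ := ih (f - algebraMap K F c * (S.x1 ^ k * S.η j)) (by
          rw [mem_LMinusD_iff (X.ring.sub_mem hfR hcR), ev_sub hfR hcR, ev_const_mul hxR,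
            ev_mul (X.ring.pow_mem S.x1_mem _) hηR, (mem_LMinusD_iff hηR).1 (S.η_mem j hj),
            (mem_LMinusD_iff hfR).1 hf]
          simp) (hc.mono (by rw [hp]; have := h h0; push_cast at this; linarith))
      refine ⟨q + Pi.single j (C c * Polynomial.X ^ k), ?_⟩
      simp only [Pi.add_apply, map_add, add_mul, Finset.sum_add_distrib]
      rw [← hq, Finset.sum_eq_single j]
      · simp [mul_assoc]
      · intro i _ hij; simp [hij]
      · intro hn; exact absurd (Finset.mem_range.2 hj) hn
  refine key ((X.poleOrd f).toNat + 1) f hf ((poleLE_self f).mono ?_)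
  push_cast
  have := Int.self_le_toNat (X.poleOrd f)
  linarith

theorem generates_init {h : F} (hh : h ∈ X.ring) (hev : X.ev h = r)
    (hf : ∀ i < S.a1, f i = (-(S.y i * h), S.y i)) (hg : ∀ i < S.a1, g i = (S.η i, 0)) :
    S.Generates f g r := by
  have hev0 : X.ev (0 : F) = 0 := X.evHom.map_zero
  refine ⟨fun i hi => ⟨?_, ?_⟩, fun e he => ?_⟩
  · rw [hf i hi]
    refine ⟨X.ring.neg_mem (X.ring.mul_mem (S.y_mem i) hh), S.y_mem i, ?_⟩
    simp only
    rw [ev_neg (X.ring.mul_mem (S.y_mem i) hh), ev_mul (S.y_mem i) hh, hev]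
    ring
  · rw [hg i hi]
    refine ⟨(S.η_mem i hi).1, X.ring.zero_mem, ?_⟩
    simp only
    rw [(mem_LMinusD_iff (S.η_mem i hi).1).1 (S.η_mem i hi), hev0]
    simp
  · obtain ⟨h1, h2, h3⟩ := he
    have h4 := X.ring.mul_mem h2 hh
    -- The value of a relation at `z = h` vanishes on `D`, so it is a combination of the `η_j`; the
    -- `z`-part supplies the coefficients of the `f_i`.
    obtain ⟨q, hq⟩ := S.exists_expand_η (f := e.1 + e.2 * h) (by
      rw [mem_LMinusD_iff (X.ring.add_mem h1 h4), ev_add h1 h4, ev_mul h2 hh, hev, h3])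
    obtain ⟨p, hp⟩ := S.exists_expand h2
    have hp' : e.2 = ∑ j ∈ Finset.range S.a1, aeval S.x1 (p j) * S.y j := hp
    refine ⟨p, q, ?_⟩
    have hcomb : S.comb f g p q = ∑ i ∈ Finset.range S.a1,
        (aeval S.x1 (p i) • (-(S.y i * h), S.y i) + aeval S.x1 (q i) • (S.η i, (0 : F))) := by
      refine Finset.sum_congr rfl fun i hi => ?_
      rw [hf i (Finset.mem_range.1 hi), hg i (Finset.mem_range.1 hi)]
    rw [hcomb]
    ext
    · simp only [Prod.fst_sum, Prod.fst_add, Prod.smul_fst, smul_eq_mul, Finset.sum_add_distrib]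
      rw [← hq]
      have : ∑ i ∈ Finset.range S.a1, aeval S.x1 (p i) * -(S.y i * h) = -(e.2 * h) := by
        rw [hp', Finset.sum_mul, ← Finset.sum_neg_distrib]
        exact Finset.sum_congr rfl fun i _ => by ring
      rw [this]
      ring
    · simp only [Prod.snd_sum, Prod.snd_add, Prod.smul_snd, smul_eq_mul, mul_zero, add_zero]
      exact hp'

theorem Reaches.mem_H (h : S.Reaches Γ τ r N s f g rs) : s ∈ X.H := by
  cases h with
  | init h hspan _ hN =>
    exact ⟨h, span_φ_le hspan, hN⟩
  | step _ _ _ _ _ _ _ _ _ _ hprec => exact hprec.1.1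

theorem Reaches.mem_relations (h : S.Reaches Γ τ r N s f g rs) :
    ∀ i < S.a1, f i ∈ X.relations rs ∧ g i ∈ X.relations rs := by
  induction h with
  | init h hspan hev hN f g hf hg => exact (generates_init (span_φ_le hspan) hev hf hg).1
  | step s f g rs w s' f' g' _ _ _ hreb ih => exact hreb.mem_relations ih

/-- Independence is required only at the end and is pulled back along the run, because intermediate
leading terms are not under control once a step crosses a gap. -/
theorem Reaches.generates (h : S.Reaches Γ τ r N s f g rs) (hi : S.Indep f g) :
    S.Generates f g rs := by
  induction h with
  | init h hspan hev hN f g hf hg => exact generates_init (span_φ_le hspan) hev hf hg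
  | step s f g rs w s' f' g' hprev hw hprec hreb ih =>
    have ht := hreb.hasTransition hi
    exact ht.generates (ih (ht.indep hi)) (hreb.mem_relations hprev.mem_relations)

theorem Reaches.le (h : S.Reaches Γ τ r N s f g rs) : s ≤ N := by
  induction h with
  | init => exact le_rfl
  | step _ _ _ _ _ _ _ _ _ _ hprec _ ih => exact hprec.1.2.le.trans ih

/-- Rebasing yields leading terms for the weight `s - 1`, which is the weight of the next step only
if `s - 1` is itself a nongap. -/
theorem Reaches.leads (h : S.Reaches Γ τ r N s f g rs) (hgap : ∀ u, s < u → u < N → u ∈ X.H) :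
    S.Leads s f g := by
  induction h with
  | init h hspan hev hN f g hf hg =>
    intro i hi
    have hN' := X.poleOrd_eq_of_vQ hN
    rw [hf i hi, hg i hi]
    refine ⟨⟨S.y_ne_zero i, ?_, ?_⟩, S.η_ne i hi, S.η_class i hi, PoleLE.zero _⟩
    · rw [S.poleOrd_y hi]; exact_mod_cast S.b_mod hi
    · have := ((poleLE_self (X := X) (S.y i)).mul (poleLE_self h)).neg
      rwa [hN'.2] at this
  | step s f g rs w s' f' g' hprev hw hprec hreb ih =>
    have hlt : s' < s := hprec.1.2
    have hL := ih fun u hu => hgap u (hlt.trans hu)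
    have hs' : (s' : ℤ) = s - 1 := by
      rcases Nat.lt_or_ge s' (s - 1) with h1 | h1
      · exact absurd (hprec.2 ⟨hgap (s - 1) h1 (by have := hprev.le; omega), by omega⟩) (by omega)
      · omega
    rw [hs']
    refine hreb.leads hL hprev.mem_H fun i hi => ?_
    have := hprev.mem_relations i hi
    exact ⟨⟨this.1.1, this.1.2.1⟩, this.2.1⟩

end StandardForm

/-! ### Dimension counts by standard monomials -/

namespace StandardForm

open PointedCurve

variable {K F : Type*} [Field K] [Field F] [Algebra K F] {n : ℕ} {X : PointedCurve K F n} {t : ℕ}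
  (S : StandardForm X t)

theorem exists_poleOrd_eq {f : F} (hf : f ∈ X.ring) (h0 : f ≠ 0) {i : ℕ} (hi : i < S.a1)
    (hmod : X.poleOrd f % (S.a1 : ℤ) = i) : ∃ k : ℕ, X.poleOrd f = S.b i + S.a1 * k :=
  ⟨(S.coord f i).natDegree, by rw [(S.coord_lead hf h0 hi hmod).2.1]; ring⟩

/-- Families of polynomials `p_i`, `i < a_1`, of degrees less than `N_i`. -/
abbrev BoundedCoord (N : ℕ → ℕ) : Type _ := (i : Fin S.a1) → degreeLT K (N i)

instance finite_degreeLT (m : ℕ) : Module.Finite K (degreeLT K m) :=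
  Module.Finite.equiv (degreeLTEquiv K m).symm

theorem finrank_boundedCoord (N : ℕ → ℕ) :
    Module.finrank K (S.BoundedCoord N) = ∑ i ∈ Finset.range S.a1, N i := by
  rw [Module.finrank_pi_fintype, Finset.sum_range]
  refine Finset.sum_congr rfl fun i _ => ?_
  rw [(degreeLTEquiv K (N i)).finrank_eq, Module.finrank_fin_fun]

/-- The polynomials of a bounded family, indexed by `ℕ`. -/
def extendCoord {N : ℕ → ℕ} (c : S.BoundedCoord N) (j : ℕ) : K[X] :=
  if h : j < S.a1 then (c ⟨j, h⟩ : K[X]) else 0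

/-- The map `(p_i) ↦ ∑ p_i(x_1) y_i`. -/
def boundedExpand (N : ℕ → ℕ) : S.BoundedCoord N →ₗ[K] X.ring where
  toFun c := ⟨S.expand (S.extendCoord c), S.expand_mem _⟩
  map_add' c d := by
    ext
    simp only [Subalgebra.coe_add]
    rw [← S.expand_add]
    congr 1
    ext1 j
    simp only [extendCoord, Pi.add_apply]
    split_ifs <;> simp
  map_smul' r c := by
    ext
    simp only [RingHom.id_apply, Subalgebra.coe_smul, expand, Finset.smul_sum]
    refine Finset.sum_congr rfl fun j hj => ?_
    simp [extendCoord, Finset.mem_range.1 hj]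

/-- A nonzero combination would have a leading monomial `x_1^k y_i` with `k < N_i`, contrary to the
bound on its pole order. -/
theorem boundedExpand_ker {N : ℕ → ℕ} {c : S.BoundedCoord N}
    (hc : ∀ i < S.a1, (S.boundedExpand N c : F) ≠ 0 →
      X.poleOrd (S.boundedExpand N c : F) % (S.a1 : ℤ) = i →
      (S.b i + S.a1 * N i : ℤ) ≤ X.poleOrd (S.boundedExpand N c : F)) : c = 0 := by
  have hval : (S.boundedExpand N c : F) = S.expand (S.extendCoord c) := rfl
  rw [hval] at hc
  have h0 : S.expand (S.extendCoord c) = 0 := by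
    by_contra hne
    rcases (S.affDeg_expand one_pos 0 (S.extendCoord c)).2 with h | ⟨i, hi, h⟩
    · exact hne (affDeg_eq_bot.1 h)
    · rw [Finset.mem_range] at hi
      have hp : S.extendCoord c i ≠ 0 := by
        intro hp
        rw [hp, map_zero, zero_mul, (isDegreeLike_affDeg one_pos 0).zero, affDeg_eq_bot] at h
        exact hne h
      obtain ⟨h1, h2⟩ := S.poleOrd_aeval_mul_y hp hi
      rw [affDeg_of_ne hne, affDeg_of_ne h1, WithBot.coe_inj] at h
      have h3 : X.poleOrd (S.expand (S.extendCoord c)) =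
        X.poleOrd (aeval S.x1 (S.extendCoord c i) * S.y i) := by linarith
      have h4 := hc i hi hne (by rw [h3, S.poleOrd_aeval_mul_y_mod hp hi])
      have h5 : (S.extendCoord c i).natDegree < N i := by
        rw [natDegree_lt_iff_degree_lt hp, ← mem_degreeLT]
        simp [extendCoord, hi]
      rw [h3, h2] at h4
      have h6 : (1 : ℤ) ≤ S.a1 := by exact_mod_cast S.a1_pos
      have h7 : ((S.extendCoord c i).natDegree : ℤ) + 1 ≤ N i := by exact_mod_cast h5
      nlinarith
  ext1 i
  have := S.expand_eq_zero h0 i.2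
  simpa [extendCoord] using this

/-- Monomials `x_1^k y_i` with `k < N_i` are linearly independent modulo a subspace of `𝓛(∞Q)`
whose nonzero elements have no such leading monomial. -/
theorem injective_comp_boundedExpand {N : ℕ → ℕ} {V : Type*} [AddCommGroup V] [Module K V]
    (θ : X.ring →ₗ[K] V)
    (hθ : ∀ f : X.ring, θ f = 0 → (f : F) ≠ 0 → ∀ i < S.a1, X.poleOrd (f : F) % (S.a1 : ℤ) = i →
      (S.b i + S.a1 * N i : ℤ) ≤ X.poleOrd (f : F)) :
    Function.Injective (θ ∘ₗ S.boundedExpand N) := by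
  rw [← LinearMap.ker_eq_bot, LinearMap.ker_eq_bot']
  intro c hc
  exact S.boundedExpand_ker fun i hi hne hmod => hθ _ hc hne i hi hmod

theorem φ_eq_boundedExpand {N : ℕ → ℕ} {u : ℕ} (hu : u ∈ X.H)
    (hlt : u < S.b (u % S.a1) + S.a1 * N (u % S.a1)) :
    ∃ c, (S.boundedExpand N c : F) = S.φ u := by
  have hi := Nat.mod_lt u S.a1_pos
  set i := u % S.a1 with hidef
  have hb := S.eq_b_add hu
  rw [← hidef] at hb
  set k := (u - S.b i) / S.a1 with hk
  have hkN : k < N i := by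
    have : S.a1 * k < S.a1 * N i := by omega
    exact lt_of_mul_lt_mul_left this (Nat.zero_le _)
  have hmem : (Polynomial.X : K[X]) ^ k ∈ degreeLT K (N i) := by
    rw [mem_degreeLT, degree_X_pow]
    exact_mod_cast hkN
  refine ⟨Pi.single ⟨i, hi⟩ ⟨_, hmem⟩, ?_⟩
  change S.expand _ = _
  rw [φ, ← hidef, ← hk]
  have : S.extendCoord (N := N) (Pi.single ⟨i, hi⟩ ⟨Polynomial.X ^ k, hmem⟩) =
      Pi.single i (Polynomial.X ^ k) := by
    ext1 j
    by_cases hj : j < S.a1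
    · by_cases hji : j = i
      · subst hji
        simp [extendCoord, hi]
      · simp [extendCoord, hj, hji]
    · have hji : j ≠ i := by rintro rfl; exact hj hi
      simp [extendCoord, hj, hji]
  rw [this, S.expand_single hi]
  simp

/-- The elements of `𝓛(∞Q) z ⊕ 𝓛(∞Q)` whose values at the points `(P_i, v_i)` lie in `T`. -/
def valuesIn (X : PointedCurve K F n) (v : Fin n → K) (T : Submodule K (Fin n → K)) :
    Submodule K (F × F) where
  carrier := {e | e.1 ∈ X.ring ∧ e.2 ∈ X.ring ∧ X.ev e.1 + X.ev e.2 * v ∈ T}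
  zero_mem' := by
    have h : X.ev (0 : F) = 0 := X.evHom.map_zero
    simp [h, X.ring.zero_mem]
  add_mem' := by
    rintro a b ⟨h1, h2, h3⟩ ⟨h4, h5, h6⟩
    refine ⟨X.ring.add_mem h1 h4, X.ring.add_mem h2 h5, ?_⟩
    rw [Prod.fst_add, Prod.snd_add, ev_add h1 h4, ev_add h2 h5]
    convert T.add_mem h3 h6 using 1
    ring
  smul_mem' := by
    rintro c a ⟨h1, h2, h3⟩
    refine ⟨X.ring.smul_mem h1 c, X.ring.smul_mem h2 c, ?_⟩
    rw [Prod.smul_fst, Prod.smul_snd, Algebra.smul_def, Algebra.smul_def, ev_const_mul h1,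
      ev_const_mul h2, smul_mul_assoc, ← smul_add]
    exact T.smul_mem c h3

theorem mem_valuesIn_of_relations {v : Fin n → K} {T : Submodule K (Fin n → K)} {e : F × F}
    (he : e ∈ X.relations v) : e ∈ valuesIn X v T :=
  ⟨he.1, he.2.1, by rw [he.2.2]; exact T.zero_mem⟩

variable {S}

/-- Division by `f` and `g`: the monomials that are not leading monomials of multiples of the `f_i`
and `g_i` span `𝓛(∞Q) z ⊕ 𝓛(∞Q)` modulo the relations. -/
theorem Leads.mem_valuesIn {s : ℕ} {f g : ℕ → F × F} (hL : S.Leads s f g) {v : Fin n → K}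
    (hmem : ∀ i < S.a1, f i ∈ X.relations v ∧ g i ∈ X.relations v)
    {T : Submodule K (Fin n → K)} {α β : ℕ → ℕ}
    (hα : ∀ i < S.a1, X.poleOrd (f i).2 = S.b i + S.a1 * α i)
    (hβ : ∀ i < S.a1, X.poleOrd (g i).1 = S.b i + S.a1 * β i)
    (hTα : ∀ u ∈ X.H, u < S.b (u % S.a1) + S.a1 * α (u % S.a1) → X.ev (S.φ u) * v ∈ T)
    (hTβ : ∀ u ∈ X.H, u < S.b (u % S.a1) + S.a1 * β (u % S.a1) → X.ev (S.φ u) ∈ T)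
    {e : F × F} (h1 : e.1 ∈ X.ring) (h2 : e.2 ∈ X.ring) : e ∈ valuesIn X v T := by
  have hev0 : X.ev (0 : F) = 0 := X.evHom.map_zero
  have hmul : ∀ {k : ℕ} {e : F × F}, e ∈ X.relations v → S.x1 ^ k • e ∈ X.relations v :=
    fun he => smul_mem_relations he (X.ring.pow_mem S.x1_mem _)
  have key : ∀ (m : ℕ) (e : F × F), e.1 ∈ X.ring → e.2 ∈ X.ring → X.PoleLE e.1 (m - 1) →
      X.PoleLE e.2 (m - 1 - s) → e ∈ valuesIn X v T := by
    intro m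
    induction m with
    | zero =>
      intro e h1 h2 h3 h4
      have h5 : e = 0 := Prod.ext (X.eq_zero_of_poleLE_neg h1 (by norm_num) h3)
        (X.eq_zero_of_poleLE_neg h2 (by push_cast; omega) h4)
      rw [h5]
      exact Submodule.zero_mem _
    | succ m ih =>
      -- Ties go to `z`, so the `z`-term of weighted degree `m` is removed first. That may change
      -- the `z`-free term of degree `m`, which this step removes afterwards.
      have step1 : ∀ e : F × F, e.1 ∈ X.ring → e.2 ∈ X.ring → X.PoleLE e.1 m →
          X.PoleLE e.2 (m - 1 - s) → e ∈ valuesIn X v T := by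
        intro e h1 h2 h3 h4
        by_cases h5 : X.PoleLE e.1 (m - 1)
        · exact ih e h1 h2 h5 h4
        have h0 : e.1 ≠ 0 := fun h0 => h5 (h0 ▸ PoleLE.zero _)
        have hp : X.poleOrd e.1 = m := by
          have h6 := h3 h0
          have h7 : ¬ X.poleOrd e.1 ≤ m - 1 := fun h => h5 fun _ => h
          omega
        have hmH := X.mem_H_of_poleOrd h1 h0 hp
        have hj := Nat.mod_lt m S.a1_pos
        suffices h : ∃ e' ∈ valuesIn X v T, e'.1 ≠ 0 ∧ X.poleOrd e'.1 = m ∧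
            X.PoleLE e'.2 (m - 1 - s) by
          obtain ⟨e', he', h6, h7, h8⟩ := h
          obtain ⟨c, hc⟩ := X.exists_sub_poleLE (f := e.1) h6 (by rw [h7, ← hp]; exact poleLE_self _)
          rw [h7] at hc
          have h9 := ih (e - c • e') (X.ring.sub_mem h1 (X.ring.smul_mem he'.1 c))
            (X.ring.sub_mem h2 (X.ring.smul_mem he'.2.1 c))
            (by simpa [Algebra.smul_def] using hc)
            (by simpa [Algebra.smul_def] using h4.sub (h8.const_mul c))
          have := Submodule.add_mem _ h9 (Submodule.smul_mem _ c he')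
          rwa [sub_add_cancel] at this
        -- A standard monomial has its value in `T` by hypothesis; any other is the leading monomial
        -- of a multiple of `g_j`.
        rcases Nat.lt_or_ge m (S.b (m % S.a1) + S.a1 * β (m % S.a1)) with h | h
        · refine ⟨(S.φ m, 0), ⟨S.φ_mem m, X.ring.zero_mem, ?_⟩, S.φ_ne_zero m, S.poleOrd_φ hmH,
            PoleLE.zero _⟩
          simpa [hev0] using hTβ m hmH h
        · have hb := S.eq_b_add hmH
          set j := m % S.a1
          set k := (m - S.b j) / S.a1
          have hk : β j ≤ k := by
            have : S.a1 * β j ≤ S.a1 * k := by omega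
            exact le_of_mul_le_mul_left this S.a1_pos
          obtain ⟨hO0, -, hOle⟩ := (hL j hj).2
          have hx0 : S.x1 ^ (k - β j) ≠ 0 := pow_ne_zero _ S.x1_ne_zero
          have hxp : X.poleOrd (S.x1 ^ (k - β j)) + X.poleOrd (g j).1 = m := by
            rw [X.poleOrd_pow S.x1_ne_zero, S.poleOrd_x1, hβ j hj]
            push_cast [hk]
            have : (m : ℤ) = S.b j + S.a1 * k := by exact_mod_cast hb
            rw [this]; ring
          refine ⟨S.x1 ^ (k - β j) • g j, mem_valuesIn_of_relations (hmul (hmem j hj).2),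
            mul_ne_zero hx0 hO0, ?_, ?_⟩
          · rw [Prod.smul_fst, smul_eq_mul, X.poleOrd_mul hx0 hO0, hxp]
          · exact ((poleLE_self _).mul hOle).mono (by linarith)
      intro e h1 h2 h3 h4
      push_cast at h3 h4
      rw [add_sub_cancel_right] at h3 h4
      by_cases h5 : X.PoleLE e.2 (m - 1 - s)
      · exact step1 e h1 h2 h3 h5
      have h0 : e.2 ≠ 0 := fun h0 => h5 (h0 ▸ PoleLE.zero _)
      obtain ⟨u, hu⟩ := Int.eq_ofNat_of_zero_le (X.poleOrd_nonneg h2)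
      have hum : (u : ℤ) = m - s := by
        have h6 := h4 h0
        have h7 : ¬ X.poleOrd e.2 ≤ m - 1 - s := fun h => h5 fun _ => h
        omega
      have huH := X.mem_H_of_poleOrd h2 h0 hu
      have hi := Nat.mod_lt u S.a1_pos
      suffices h : ∃ e' ∈ valuesIn X v T, e'.2 ≠ 0 ∧ X.poleOrd e'.2 = u ∧ X.PoleLE e'.1 m by
        obtain ⟨e', he', h6, h7, h8⟩ := h
        obtain ⟨c, hc⟩ := X.exists_sub_poleLE (f := e.2) h6
          (by rw [h7, ← hu]; exact poleLE_self _)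
        rw [h7, hum] at hc
        have h9 := step1 (e - c • e') (X.ring.sub_mem h1 (X.ring.smul_mem he'.1 c))
          (X.ring.sub_mem h2 (X.ring.smul_mem he'.2.1 c))
          (by simpa [Algebra.smul_def] using h3.sub (h8.const_mul c))
          (by
            have := hc.mono (show (m : ℤ) - s - 1 ≤ m - 1 - s by linarith)
            simpa [Algebra.smul_def] using this)
        have := Submodule.add_mem _ h9 (Submodule.smul_mem _ c he')
        rwa [sub_add_cancel] at this
      rcases Nat.lt_or_ge u (S.b (u % S.a1) + S.a1 * α (u % S.a1)) with h | h
      · refine ⟨(0, S.φ u), ⟨X.ring.zero_mem, S.φ_mem u, ?_⟩, S.φ_ne_zero u, S.poleOrd_φ huH,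
          PoleLE.zero _⟩
        simpa [hev0] using hTα u huH h
      · have hb := S.eq_b_add huH
        set i := u % S.a1
        set k := (u - S.b i) / S.a1
        have hk : α i ≤ k := by
          have : S.a1 * α i ≤ S.a1 * k := by omega
          exact le_of_mul_le_mul_left this S.a1_pos
        obtain ⟨hZ0, -, hZle⟩ := (hL i hi).1
        have hx0 : S.x1 ^ (k - α i) ≠ 0 := pow_ne_zero _ S.x1_ne_zero
        have hxp : X.poleOrd (S.x1 ^ (k - α i)) + X.poleOrd (f i).2 = u := by
          rw [X.poleOrd_pow S.x1_ne_zero, S.poleOrd_x1, hα i hi]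
          push_cast [hk]
          have : (u : ℤ) = S.b i + S.a1 * k := by exact_mod_cast hb
          rw [this]; ring
        refine ⟨S.x1 ^ (k - α i) • f i, mem_valuesIn_of_relations (hmul (hmem i hi).1),
          mul_ne_zero hx0 hZ0, ?_, ?_⟩
        · rw [Prod.smul_snd, smul_eq_mul, X.poleOrd_mul hx0 hZ0, hxp]
        · exact ((poleLE_self _).mul hZle).mono (by linarith)
  refine key ((X.poleOrd e.1).toNat + (X.poleOrd e.2).toNat + s + 1) e h1 h2
    ((poleLE_self _).mono ?_) ((poleLE_self _).mono ?_)
  · push_cast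
    have := Int.self_le_toNat (X.poleOrd e.1)
    have := Int.natCast_nonneg (X.poleOrd e.2).toNat
    omega
  · push_cast
    have := Int.self_le_toNat (X.poleOrd e.2)
    have := Int.natCast_nonneg (X.poleOrd e.1).toNat
    omega

/-- The codimension of `𝓛(-D + ∞Q)` is at most that of the relations, computed from leading
monomials. -/
theorem Leads.sum_η_le {s : ℕ} {f g : ℕ → F × F} (hL : S.Leads s f g) {v : Fin n → K}
    (hmem : ∀ i < S.a1, f i ∈ X.relations v ∧ g i ∈ X.relations v) {α β δ : ℕ → ℕ}
    (hα : ∀ i < S.a1, X.poleOrd (f i).2 = S.b i + S.a1 * α i)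
    (hβ : ∀ i < S.a1, X.poleOrd (g i).1 = S.b i + S.a1 * β i)
    (hδ : ∀ i < S.a1, X.poleOrd (S.η i) = S.b i + S.a1 * δ i) :
    ∑ i ∈ Finset.range S.a1, δ i ≤
      ∑ i ∈ Finset.range S.a1, α i + ∑ i ∈ Finset.range S.a1, β i := by
  let evα : S.BoundedCoord α →ₗ[K] (Fin n → K) :=
    (LinearMap.mulRight K v) ∘ₗ X.evHom ∘ₗ S.boundedExpand α
  let evβ : S.BoundedCoord β →ₗ[K] (Fin n → K) := X.evHom ∘ₗ S.boundedExpand β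
  -- `T` is spanned by the values of the standard monomials; those with `z` are evaluated at `z =
  -- v`, hence multiplied by `v`.
  let T := LinearMap.range (evα.coprod evβ)
  have hT : ∀ f : X.ring, X.evHom f ∈ T := by
    intro e
    have h := hL.mem_valuesIn hmem (T := T) hα hβ ?_ ?_ (e := ((e : F), 0)) e.2 X.ring.zero_mem
    · have h1 := h.2.2
      have hev0 : X.ev (0 : F) = 0 := X.evHom.map_zero
      simp only [hev0, zero_mul, add_zero] at h1
      exact h1
    · intro u hu hlt
      obtain ⟨c, hc⟩ := S.φ_eq_boundedExpand hu hlt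
      refine ⟨(c, 0), ?_⟩
      rw [← hc, LinearMap.coprod_apply, map_zero, add_zero]
      rfl
    · intro u hu hlt
      obtain ⟨c, hc⟩ := S.φ_eq_boundedExpand hu hlt
      refine ⟨(0, c), ?_⟩
      rw [← hc, LinearMap.coprod_apply, map_zero, zero_add]
      rfl
  -- A function killed by `ev` lies in `𝓛(-D + ∞Q)`, so minimality of `η_i` bounds its pole order
  -- from below.
  have hinj := S.injective_comp_boundedExpand (N := δ) (X.evHom.codRestrict T hT) (by
    intro e he h0 i hi hmod
    rw [← hδ i hi]
    refine S.η_least i hi e ((mem_LMinusD_iff e.2).2 ?_) h0 hmod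
    exact congrArg Subtype.val he)
  have h1 := LinearMap.finrank_le_finrank_of_injective hinj
  have h2 : Module.finrank K T ≤ _ := LinearMap.finrank_range_le (evα.coprod evβ)
  rw [Module.finrank_prod, finrank_boundedCoord, finrank_boundedCoord] at h2
  rw [finrank_boundedCoord] at h1
  exact h1.trans h2

/-- Having no `z`-part, `η_j` is a relation of every `v`, so its leading monomial is divisible by
that of `g_j`. -/
theorem Leads.le_η {s : ℕ} {f g : ℕ → F × F} (hL : S.Leads s f g) {v : Fin n → K}
    (hG : S.Generates f g v) {j : ℕ} (hj : j < S.a1) :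
    X.poleOrd (g j).1 ≤ X.poleOrd (S.η j) := by
  have hR : S.η j ∈ X.ring := (S.η_mem j hj).1
  have hev0 : X.ev (0 : F) = 0 := X.evHom.map_zero
  obtain ⟨p, q, hpq⟩ := hG.2 (S.η j, 0) ⟨hR, X.ring.zero_mem, by
    simp only [hev0, (mem_LMinusD_iff hR).1 (S.η_mem j hj)]; simp⟩
  have h := hL.poleOrd_le_of_leadOne (p := p) (q := q) (k := j) (by
    rw [← hpq]
    exact ⟨S.η_ne j hj, S.η_class j hj, PoleLE.zero _⟩)
  rwa [← hpq] at h

/-- If `e` lies in the coset of `v` modulo `ev(𝓛(mQ))`, the number of monomials `m z` that are not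
leading monomials for the weight `m` of `z` is at most the Hamming weight of `e`. -/
theorem Leads.sum_le_hammingNorm [DecidableEq K] {m : ℤ} {f g : ℕ → F × F} (hL : S.Leads m f g)
    {v e : Fin n → K} (hG : S.Generates f g v) {ψ : F} (hψ : ψ ∈ X.ring) (hψm : X.PoleLE ψ m)
    (he : e = v + X.ev ψ) {α : ℕ → ℕ}
    (hα : ∀ i < S.a1, X.poleOrd (f i).2 = S.b i + S.a1 * α i) :
    ∑ i ∈ Finset.range S.a1, α i ≤ hammingNorm e := by
  -- The kernel consists of the functions that vanish on the support of `e`.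
  let θ : X.ring →ₗ[K] ({l // e l ≠ 0} → K) := LinearMap.funLeft K K Subtype.val ∘ₗ X.evHom
  have hinj := S.injective_comp_boundedExpand (N := α) θ (by
    intro a ha h0 i hi hmod
    have hae : X.ev (a : F) * e = 0 := by
      ext l
      by_cases hl : e l = 0
      · simp [hl]
      · have h2 : X.ev (a : F) l = 0 := congrFun ha ⟨l, hl⟩
        simp [h2]
    rw [← hα i hi]
    have haψ := X.ring.mul_mem a.2 hψ
    -- The element `a (z + ψ)` takes the values `ev(a) e = 0` at the points, and the bound on `ψ`
    -- makes `a z` dominate for the weight `m`.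
    obtain ⟨p, q, hpq⟩ := hG.2 ((a : F) * ψ, (a : F)) ⟨haψ, a.2, by
      simp only
      rw [ev_mul a.2 hψ, ← hae, he]
      ring⟩
    have h := hL.poleOrd_le_of_leadZ (p := p) (q := q) (k := i) (by
      rw [← hpq]
      exact ⟨h0, hmod, (poleLE_self _).mul hψm⟩)
    rwa [← hpq] at h)
  have h1 := LinearMap.finrank_le_finrank_of_injective hinj
  rw [finrank_boundedCoord, Module.finrank_fintype_fun_eq_card, Fintype.card_subtype] at h1
  exact h1

end StandardForm

end

/-! ### The vote inequality -/

theorem proposition2 {K F : Type*} [Field K] [Finite K] [DecidableEq K] [Field F] [Algebra K F]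
    (hF : IsFunctionField K F) {n t : ℕ} (X : PointedCurve K F n) (S : StandardForm X t)
    (Γ : Set ℕ) (hΓ : Γ ⊆ X.Hhat) (τ : ℕ) (r : Fin n → K) (N s : ℕ) (hs : s ∈ Γ)
    (f g : ℕ → F × F) (rs : Fin n → K) (hrun : S.Reaches Γ τ r N s f g rs)
    (hLT : (∃ u, s < u ∧ u < N ∧ u ∉ X.H) →
      ∀ i < S.a1, S.LeadsAtZ s i (f i) ∧ S.LeadsAtOne s i (g i))
    (ω : K) (e : Fin n → K)
    (he : StandardForm.IsMinWeightIn (rs - X.ev (algebraMap K F ω * S.φ s))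
      (X.code ((s : ℤ) - 1)) e) :
    S.votesFor s f g ω ≥ S.votesAgainst s f g ω - 2 * (hammingNorm e : ℚ) + S.nu s := by
  classical
  have hsH := hrun.mem_H
  have hL : S.Leads s f g := by
    by_cases hgap : ∃ u, s < u ∧ u < N ∧ u ∉ X.H
    · exact S.leads_iff.2 (hLT hgap)
    · push Not at hgap
      exact hrun.leads hgap
  have hG := hrun.generates hL.indep
  have hR := hG.mem_ring
  -- A hypothetical step with the value `ω`, used only to count monomials for the weight `s - 1`.
  obtain ⟨f', g', hreb⟩ := S.exists_isRebasing s ω f g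
  have hL' := hreb.leads hL hsH hR
  have hG' := (hreb.hasTransition hL'.indep).generates hG (hreb.mem_relations hG.1)
  have hR' := hG'.mem_ring
  have hα : ∀ i : ℕ, ∃ k : ℕ, i < S.a1 → X.poleOrd (f i).2 = S.b i + S.a1 * k := fun i => by
    by_cases hi : i < S.a1
    · obtain ⟨k, hk⟩ := S.exists_poleOrd_eq (hR i hi).1.2 (hL i hi).1.1 hi (hL i hi).1.2.1
      exact ⟨k, fun _ => hk⟩
    · exact ⟨0, fun h => absurd h hi⟩
  have hα' : ∀ i : ℕ, ∃ k : ℕ, i < S.a1 → X.poleOrd (f' i).2 = S.b i + S.a1 * k := fun i => by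
    by_cases hi : i < S.a1
    · obtain ⟨k, hk⟩ := S.exists_poleOrd_eq (hR' i hi).1.2 (hL' i hi).1.1 hi (hL' i hi).1.2.1
      exact ⟨k, fun _ => hk⟩
    · exact ⟨0, fun h => absurd h hi⟩
  have hβ : ∀ i : ℕ, ∃ k : ℕ, i < S.a1 → X.poleOrd (g i).1 = S.b i + S.a1 * k := fun i => by
    by_cases hi : i < S.a1
    · obtain ⟨k, hk⟩ := S.exists_poleOrd_eq (hR i hi).2 (hL i hi).2.1 hi (hL i hi).2.2.1
      exact ⟨k, fun _ => hk⟩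
    · exact ⟨0, fun h => absurd h hi⟩
  have hδ : ∀ i : ℕ, ∃ k : ℕ, i < S.a1 → X.poleOrd (S.η i) = S.b i + S.a1 * k := fun i => by
    by_cases hi : i < S.a1
    · obtain ⟨k, hk⟩ := S.exists_poleOrd_eq (S.η_mem i hi).1 (S.η_ne i hi) hi (S.η_class i hi)
      exact ⟨k, fun _ => hk⟩
    · exact ⟨0, fun h => absurd h hi⟩
  choose α hα using hα
  choose α' hα' using hα'
  choose β hβ using hβ
  choose δ hδ using hδ
  have ha1 : (0 : ℤ) < S.a1 := by exact_mod_cast S.a1_pos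
  have h1 := hL.sum_η_le hG.1 hα hβ hδ
  obtain ⟨_, ⟨ψ, ⟨hψ, hψs⟩, rfl⟩, hψe⟩ := he.1
  have h3 := hL'.sum_le_hammingNorm hG' hψ (PointedCurve.poleLE_iff X |>.2 hψs) hψe.symm hα'
  have hαα' : ∀ i ∈ Finset.range S.a1, (α' i : ℤ) =
      α i + if S.vote s f i = ω then 0 else S.cBar s f g i := by
    intro i hi
    rw [Finset.mem_range] at hi
    have h := (hreb.lead hL hsH hR hi).2.2
    rw [hα i hi, hα' i hi] at h
    apply mul_left_cancel₀ ha1.ne'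
    rw [mul_add]
    split_ifs at h ⊢ <;> linarith
  -- With `c_i` in place of `c̄_i` the right side is exactly the first entry of the maximum. It is
  -- nonnegative because `β ≤ δ`.
  have hν : ∀ i ∈ Finset.range S.a1,
      max (X.poleOrd (S.η (S.idx s i)) - X.poleOrd (S.y i) - s) 0 ≤
        S.a1 * (S.cBar s f g i + (δ (S.idx s i) - β (S.idx s i) : ℤ) + α i) := by
    intro i hi
    rw [Finset.mem_range] at hi
    have hi' := S.idx_lt s i
    obtain ⟨d, d', D⟩ := hL.exists_pairData hsH hR hi
    have h4 := D.a1_mul_cPair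
    rw [← D.poleOrd_f, ← D.poleOrd_g, hα i hi, hβ _ hi'] at h4
    have h5 := hL.le_η hG hi'
    rw [hβ _ hi', hδ _ hi'] at h5
    have h6 : (β (S.idx s i) : ℤ) ≤ δ (S.idx s i) := le_of_mul_le_mul_left (by linarith) ha1
    have h7 : S.cPair s f g i ≤ S.cBar s f g i := le_max_left _ _
    have h8 : 0 ≤ S.cBar s f g i := le_max_right _ _
    refine max_le ?_ (mul_nonneg ha1.le (by have := Int.natCast_nonneg (α i); linarith))
    rw [hδ _ hi', S.poleOrd_y hi]
    have h9 := mul_le_mul_of_nonneg_left h7 ha1.le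
    linarith
  have hsum := Finset.sum_le_sum hν
  rw [← Finset.mul_sum, Finset.sum_add_distrib, Finset.sum_add_distrib, Finset.sum_sub_distrib,
    S.sum_idx s (fun i => (δ i : ℤ)), S.sum_idx s (fun i => (β i : ℤ))] at hsum
  have h3' : (∑ i ∈ Finset.range S.a1, (α' i : ℤ)) ≤ hammingNorm e := by exact_mod_cast h3
  rw [Finset.sum_congr rfl hαα', Finset.sum_add_distrib] at h3'
  have h1' : (∑ i ∈ Finset.range S.a1, (δ i : ℤ)) ≤
      ∑ i ∈ Finset.range S.a1, (α i : ℤ) + ∑ i ∈ Finset.range S.a1, (β i : ℤ) := by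
    exact_mod_cast h1
  have hag : S.votesAgainst s f g ω = ((∑ i ∈ Finset.range S.a1,
      if S.vote s f i = ω then 0 else S.cBar s f g i : ℤ) : ℚ) := by
    rw [StandardForm.votesAgainst, Finset.sum_filter, Int.cast_sum]
    refine Finset.sum_congr rfl fun i _ => ?_
    by_cases h : S.vote s f i = ω <;> simp [h]
  have hall : S.votesFor s f g ω + S.votesAgainst s f g ω =
      ((∑ i ∈ Finset.range S.a1, S.cBar s f g i : ℤ) : ℚ) := by
    rw [StandardForm.votesFor, StandardForm.votesAgainst, Int.cast_sum]
    convert Finset.sum_filter_add_sum_filter_not (Finset.range S.a1)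
      (fun i => S.vote s f i = ω) (fun i => (S.cBar s f g i : ℚ))
  have hnu : S.nu s ≤ ((∑ i ∈ Finset.range S.a1, S.cBar s f g i +
      2 * ∑ i ∈ Finset.range S.a1, (α i : ℤ) : ℤ) : ℚ) := by
    have ha1' : (0 : ℚ) < S.a1 := by exact_mod_cast S.a1_pos
    rw [StandardForm.nu, one_div, inv_mul_le_iff₀ ha1', ← Int.cast_sum]
    -- Here `∑ δ - ∑ β ≤ ∑ α` turns the single `∑ α` into `2 ∑ α`.
    have h4 := hsum.trans (mul_le_mul_of_nonneg_left (show _ ≤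
      ∑ i ∈ Finset.range S.a1, S.cBar s f g i + 2 * ∑ i ∈ Finset.range S.a1, (α i : ℤ) by
        linarith) ha1.le)
    exact_mod_cast h4
  have h3q : ((∑ i ∈ Finset.range S.a1, (α i : ℤ) : ℤ) : ℚ) + S.votesAgainst s f g ω ≤
      hammingNorm e := by
    rw [hag]
    exact_mod_cast h3'
  push_cast at hnu h3q hall
  linarith
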